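/- Let $\Sigma=\{0,1\}$ and let $\Sigma^*$ be the set of finite non-empty strings over $\Sigma$. A promise problem is a function $\phi$ assigning to each $x\in\Sigma^*$ a non-empty subset $\phi(x)\subseteq\Sigma$ (the valid answers). For promise problems write $\phi_1\propto\phi_2$ if there is a function $\mu:\Sigma^*\to\Sigma^*$, computed by a Turing machine in time polynomial in $|x|$, such that $\phi_1(x)\supseteq\phi_2(\mu(x))$ for all $x\in\Sigma^*$; the strong closure of $\phi$ is $[\phi]=\{\psi\mid\psi\propto\phi\}$. Let $n\ge 1$. The inputs of the following problems are the strings that encode a function $f:\Sigma^{m_1}\times\cdots\times\Sigma^{m_n}\to\Sigma$ with $m_1\ge1$, given by the numbers $m_1,\dots,m_n$ (in unary) and a Boolean expression in $\land,\lor,\lnot$ and the $m_1+\cdots+m_n$ variables; on strings that are not such an encoding the value of each problem is $\Sigma$. For $x\in\Sigma^{m_1}$ let $f_x$ be the function of the remaining $n-1$ arguments obtained by fixing the first argument to be $x$, and let $x_1$ be the first bit of $x$. Put $\mathrm{SAT}_0(f)=\overline{\mathrm{SAT}}_0(f)=f$ and, for $n\ge1$, $\mathrm{SAT}_n(f)=1\iff\exists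 x\;\overline{\mathrm{SAT}}_{n-1}(f_x)=1$ and $\overline{\mathrm{SAT}}_n(f)=1\iff\forall x\;\mathrm{SAT}_{n-1}(f_x)=1$. Define * $\mathrm{USAT}_n(f)=\{\mathrm{SAT}_n(f)\}$ if at most one $x$ satisfies $\overline{\mathrm{SAT}}_{n-1}(f_x)=1$, and $\Sigma$ otherwise; * $\overline{\mathrm{USAT}}_n(f)=\{\overline{\mathrm{SAT}}_n(f)\}$ if at most one $x$ satisfies $\mathrm{SAT}_{n-1}(f_x)=0$, and $\Sigma$ otherwise; * $\mathrm{UVAL}_n(f)=\{x_1\mid\overline{\mathrm{SAT}}_{n-1}(f_x)=1\}$ if exactly one $x$ satisfies $\overline{\mathrm{SAT}}_{n-1}(f_x)=1$, and $\Sigma$ otherwise. Then, for every $n\ge1$, $$[\mathrm{UVAL}_n]=[\mathrm{USAT}_n]\cap[\overline{\mathrm{USAT}}_n].$$ (For $n=1$, $[\mathrm{USAT}_1]$ is promise-$\mathrm{UP}$ and $[\overline{\mathrm{USAT}}_1]$ is promise-$\mathrm{coUP}$, so this says that $\mathrm{UVAL}_1$ is complete for their intersection.) -/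

import Mathlib

namespace PromiseHierarchy

/-! ### Promise problems and strong reduction -/

/-- Finite non-empty strings over the alphabet `{0, 1}`. -/
abbrev Str : Type := {w : List Bool // w ≠ []}

/-- The non-empty subsets of the alphabet `{0, 1}`. -/
abbrev Answer : Type := {s : Set Bool // s.Nonempty}

/-- The whole alphabet: both answers are valid. -/
def anyAnswer : Answer := ⟨Set.univ, Set.univ_nonempty⟩

/-- The answer set `s` if the promise `P` holds, and the whole alphabet otherwise. -/
noncomputable def promise (P : Prop) (s : Set Bool) (hs : P → s.Nonempty) : Answer :=
  open Classical in if h : P then ⟨s, hs h⟩ else anyAnswer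

/-- A promise problem assigns to every string the non-empty set of its valid answers. -/
abbrev PromiseProblem : Type := Str → Answer

/-- `μ` is computed by a (multi-tape) Turing machine in time polynomial in the input length. -/
def PolyTimeComputable (μ : Str → Str) : Prop :=
  Nonempty (Turing.TM2ComputableInPolyTime
    (Subtype.val : Str → List Bool) (Subtype.val : Str → List Bool) μ)

/-- Strong (many-one) reduction between promise problems. -/
def StrongReduces (φ₁ φ₂ : PromiseProblem) : Prop :=
  ∃ μ : Str → Str, PolyTimeComputable μ ∧ ∀ x : Str, (φ₂ (μ x)).1 ⊆ (φ₁ x).1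

/-- The strong closure `[φ]`: all promise problems that strongly reduce to `φ`. -/
def strongClosure (φ : PromiseProblem) : Set PromiseProblem :=
  {ψ | StrongReduces ψ φ}

/-! ### Boolean functions in several blocks of variables -/

/-- Functions `Σ^{m 0} × ⋯ × Σ^{m (n-1)} → Σ`, where `Σ = {0, 1}`. -/
abbrev BoolFun {n : ℕ} (m : Fin n → ℕ) : Type :=
  ((i : Fin n) → (Fin (m i) → Bool)) → Bool

/-- The function of the remaining blocks obtained by fixing the first block to be `x`. -/
def BoolFun.fix {n : ℕ} {m : Fin (n + 1) → ℕ} (f : BoolFun m) (x : Fin (m 0) → Bool) :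
    BoolFun (fun i : Fin n => m i.succ) :=
  fun y => f (Fin.cons (α := fun i => Fin (m i) → Bool) x y)

/-- `n` alternating quantifiers over the blocks of `f`, the first one being `∃` if `ex = true`
and `∀` if `ex = false`. -/
def Alternating (ex : Bool) : {n : ℕ} → {m : Fin n → ℕ} → BoolFun m → Prop
  | 0, _, f => f (fun i => i.elim0) = true
  | n + 1, m, f =>
    match ex with
    | true => ∃ x : Fin (m 0) → Bool, Alternating false (n := n) (f.fix x)
    | false => ∀ x : Fin (m 0) → Bool, Alternating true (n := n) (f.fix x)

/-- `SAT f` says that `SAT_n(f) = 1`, where `n` is the number of blocks of `f`. -/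
def SAT {n : ℕ} {m : Fin n → ℕ} (f : BoolFun m) : Prop := Alternating true f

/-- `CoSAT f` says that `co-SAT_n(f) = 1`, where `n` is the number of blocks of `f`. -/
def CoSAT {n : ℕ} {m : Fin n → ℕ} (f : BoolFun m) : Prop := Alternating false f

/-- The truth value of a proposition, as a letter of the alphabet. -/
noncomputable def truth (P : Prop) : Bool := open Classical in decide P

/-! ### Boolean expressions and their encoding -/

/-- Boolean expressions in variables from `V`. -/
inductive BoolExpr (V : Type) : Type
  | var (v : V) : BoolExpr V
  | not (e : BoolExpr V) : BoolExpr V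
  | and (e₁ e₂ : BoolExpr V) : BoolExpr V
  | or (e₁ e₂ : BoolExpr V) : BoolExpr V

/-- The value of an expression under an assignment. -/
def BoolExpr.eval {V : Type} (ρ : V → Bool) : BoolExpr V → Bool
  | .var v => ρ v
  | .not e => !(e.eval ρ)
  | .and e₁ e₂ => e₁.eval ρ && e₂.eval ρ
  | .or e₁ e₂ => e₁.eval ρ || e₂.eval ρ

/-- The self-delimiting unary code `1^k 0` of `k`. -/
def unary (k : ℕ) : List Bool := List.replicate k true ++ [false]

/-- The code of an expression whose variables are the pairs (block `i`, position `j`):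
prefix notation with two-letter tags, a variable being followed by `1^i 0 1^j 0`. -/
def BoolExpr.code {n : ℕ} {m : Fin n → ℕ} : BoolExpr ((i : Fin n) × Fin (m i)) → List Bool
  | .var v => false :: false :: (unary v.1 ++ unary v.2)
  | .not e => false :: true :: e.code
  | .and e₁ e₂ => true :: false :: (e₁.code ++ e₂.code)
  | .or e₁ e₂ => true :: true :: (e₁.code ++ e₂.code)

/-- An input of a problem of level `n + 1`: the numbers `m 0, …, m n` of variables in the
`n + 1` blocks, the first of which is non-empty, and an expression in these variables. -/
structure Input (n : ℕ) : Type where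
  m : Fin (n + 1) → ℕ
  pos : 0 < m 0
  expr : BoolExpr ((i : Fin (n + 1)) × Fin (m i))

/-- The code of the numbers of variables. -/
def header {n : ℕ} (m : Fin n → ℕ) : List Bool := (List.ofFn m).flatMap unary

namespace Input

variable {n : ℕ}

/-- The function `Σ^{m 0} × ⋯ × Σ^{m n} → Σ` that the input describes. -/
def fn (F : Input n) : BoolFun F.m := fun x => F.expr.eval (fun v => x v.1 v.2)

theorem code_ne_nil (F : Input n) : header F.m ++ F.expr.code ≠ [] := by
  simp [header, unary, List.ofFn_succ]

/-- The string that encodes the input. -/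
def code (F : Input n) : Str := ⟨header F.m ++ F.expr.code, F.code_ne_nil⟩

/-- `{SAT(f)}` on the promise that at most one `x` has `co-SAT(f_x) = 1`. -/
noncomputable def usat (F : Input n) : Answer :=
  promise ({x | CoSAT (F.fn.fix x)}.ncard ≤ 1) {truth (SAT F.fn)}
    (fun _ => Set.singleton_nonempty _)

/-- `{co-SAT(f)}` on the promise that at most one `x` has `SAT(f_x) = 0`. -/
noncomputable def coUsat (F : Input n) : Answer :=
  promise ({x | ¬ SAT (F.fn.fix x)}.ncard ≤ 1) {truth (CoSAT F.fn)}
    (fun _ => Set.singleton_nonempty _)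

/-- The first bits of all `x` with `co-SAT(f_x) = 1`, on the promise that there is exactly
one such `x`. -/
noncomputable def uval (F : Input n) : Answer :=
  promise (∃! x, CoSAT (F.fn.fix x))
    {b | ∃ x : Fin (F.m 0) → Bool, CoSAT (F.fn.fix x) ∧ x ⟨0, F.pos⟩ = b}
    (fun h => h.exists.elim fun x hx => ⟨_, x, hx, rfl⟩)

end Input

/-! The encoding is injective, so that an encoded input can be recovered from its code. -/

theorem unary_append_inj {a b : ℕ} {s t : List Bool} (h : unary a ++ s = unary b ++ t) :
    a = b ∧ s = t := by
  induction a generalizing b with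
  | zero => cases b <;> simp_all [unary, List.replicate_succ]
  | succ a ih =>
    cases b with
    | zero => simp [unary, List.replicate_succ] at h
    | succ b =>
      have h' : unary a ++ s = unary b ++ t := by
        simpa [unary, List.replicate_succ] using h
      obtain ⟨h₁, h₂⟩ := ih h'
      exact ⟨by rw [h₁], h₂⟩

theorem header_append_inj {n : ℕ} {m m' : Fin n → ℕ} {s t : List Bool}
    (h : header m ++ s = header m' ++ t) : m = m' ∧ s = t := by
  induction n with
  | zero => exact ⟨Subsingleton.elim _ _, by simpa [header] using h⟩
  | succ n ih =>
    simp only [header, List.ofFn_succ, List.flatMap_cons, List.append_assoc] at h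
    obtain ⟨h₀, h₁⟩ := unary_append_inj h
    obtain ⟨h₂, h₃⟩ := ih h₁
    refine ⟨funext fun i => ?_, h₃⟩
    refine Fin.cases h₀ (fun j => ?_) i
    exact congrFun h₂ j

theorem BoolExpr.code_append_inj {n : ℕ} {m : Fin n → ℕ}
    {e e' : BoolExpr ((i : Fin n) × Fin (m i))} {s t : List Bool}
    (h : e.code ++ s = e'.code ++ t) : e = e' ∧ s = t := by
  induction e generalizing e' s t with
  | var v =>
    cases e' with
    | var v' =>
      simp only [code, List.cons_append, List.append_assoc, List.cons.injEq, true_and] at h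
      obtain ⟨h₁, h₂⟩ := unary_append_inj h
      obtain ⟨h₃, h₄⟩ := unary_append_inj h₂
      obtain ⟨i, j⟩ := v
      obtain ⟨i', j'⟩ := v'
      obtain rfl : i = i' := Fin.ext h₁
      obtain rfl : j = j' := Fin.ext h₃
      exact ⟨rfl, h₄⟩
    | _ => simp [code] at h
  | not e ih =>
    cases e' with
    | not e' =>
      simp only [code, List.cons_append, List.cons.injEq, true_and] at h
      obtain ⟨rfl, h₂⟩ := ih h
      exact ⟨rfl, h₂⟩
    | _ => simp [code] at h
  | and e₁ e₂ ih₁ ih₂ =>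
    cases e' with
    | and e₁' e₂' =>
      simp only [code, List.cons_append, List.append_assoc, List.cons.injEq, true_and] at h
      obtain ⟨rfl, h₂⟩ := ih₁ h
      obtain ⟨rfl, h₃⟩ := ih₂ h₂
      exact ⟨rfl, h₃⟩
    | _ => simp [code] at h
  | or e₁ e₂ ih₁ ih₂ =>
    cases e' with
    | or e₁' e₂' =>
      simp only [code, List.cons_append, List.append_assoc, List.cons.injEq, true_and] at h
      obtain ⟨rfl, h₂⟩ := ih₁ h
      obtain ⟨rfl, h₃⟩ := ih₂ h₂
      exact ⟨rfl, h₃⟩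
    | _ => simp [code] at h

theorem Input.code_injective (n : ℕ) : Function.Injective (Input.code (n := n)) := by
  rintro ⟨m, hm, e⟩ ⟨m', hm', e'⟩ h
  have h' : header m ++ e.code = header m' ++ e'.code := congrArg Subtype.val h
  obtain ⟨rfl, h₂⟩ := header_append_inj h'
  obtain ⟨rfl, -⟩ := BoolExpr.code_append_inj (s := []) (t := []) (by simpa using h₂)
  rfl

/-! ### The problems of level `n ≥ 1` -/

/-- The promise problem on strings given by a problem on inputs. It is part of the promise that
the string is the code of an input. -/
noncomputable def onCodes {n : ℕ} (A : Input n → Answer) : PromiseProblem :=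
  Function.extend Input.code A (fun _ => anyAnswer)

/-- The promise problem `USAT_n`, for `n ≥ 1`. -/
noncomputable def USAT : ℕ → PromiseProblem
  | 0 => fun _ => anyAnswer
  | n + 1 => onCodes (Input.usat (n := n))

/-- The promise problem `co-USAT_n`, for `n ≥ 1`. -/
noncomputable def CoUSAT : ℕ → PromiseProblem
  | 0 => fun _ => anyAnswer
  | n + 1 => onCodes (Input.coUsat (n := n))

/-- The promise problem `UVAL_n`, for `n ≥ 1`. -/
noncomputable def UVAL : ℕ → PromiseProblem
  | 0 => fun _ => anyAnswer
  | n + 1 => onCodes (Input.uval (n := n))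

end PromiseHierarchy

/-!
`UVAL` reduces to `USAT` by replacing `f` with `x₁ ∧ f`, which has the witness of `f` as its only
witness if that witness starts with `1` and none otherwise; it reduces to the complementary problem
by `x₁ ∨ ¬f`, whose counterexamples are the witnesses of `f` that start with `0`.

Conversely, let `ψ` reduce to `USAT` by `f` and to the complementary problem by `g`. The first bit
of the combined input `h` chooses between a witness `1x0…0` from `f` and a counterexample `0y0…0`
to `g`, padded by zeros to a common length. If the answers for `f` and `g` agree, exactly one of the
two exists, so `h` has a unique witness, and its first bit is the answer. If they disagree, both
answers are valid for `ψ`, and nothing is required of `h`.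

Each construction changes `f` only by conditions on the first block, so it commutes with the
remaining quantifiers. On strings it copies formulas, shifts the numbers of their variables, and
prints formulas whose size depends on a unary number, which is done in polynomial time by composing
subroutines for machines with several stacks.
-/

namespace PromiseHierarchy

open Polynomial (X C)

/-! ### Alternating quantifiers -/

theorem sat_succ {n : ℕ} {m : Fin (n + 1) → ℕ} (f : BoolFun m) :
    SAT f ↔ ∃ x, CoSAT (f.fix x) := by
  simp only [SAT, CoSAT, Alternating]

theorem coSAT_succ {n : ℕ} {m : Fin (n + 1) → ℕ} (f : BoolFun m) :
    CoSAT f ↔ ∀ x, SAT (f.fix x) := by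
  simp only [SAT, CoSAT, Alternating]

theorem alternating_comp {n : ℕ} {m M : Fin n → ℕ}
    (r : (i : Fin n) → (Fin (M i) → Bool) → (Fin (m i) → Bool))
    (hr : ∀ i, Function.Surjective (r i)) (ex : Bool) (f : BoolFun m) :
    Alternating (m := M) ex (fun y => f (fun i => r i (y i))) ↔ Alternating ex f := by
  induction n generalizing ex with
  | zero =>
    simp only [Alternating]
    rw [Subsingleton.elim (fun i => r i _) _]
  | succ n ih =>
    have fix_comp (x : Fin (M 0) → Bool) :
        BoolFun.fix (m := M) (fun y => f (fun i => r i (y i))) x =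
          fun y => f.fix (r 0 x) (fun i => r i.succ (y i)) := by
      funext y
      exact congrArg f (funext (Fin.cases rfl fun _ => rfl))
    cases ex
    · simp only [Alternating, fix_comp, ih (fun i => r i.succ) (fun i => hr i.succ)]
      exact ((hr 0).forall (p := fun z => Alternating true (f.fix z))).symm
    · simp only [Alternating, fix_comp, ih (fun i => r i.succ) (fun i => hr i.succ)]
      exact ((hr 0).exists (p := fun z => Alternating false (f.fix z))).symm

theorem alternating_not {n : ℕ} {m : Fin n → ℕ} (ex : Bool) (f : BoolFun m) :
    Alternating (m := m) ex (fun y => !(f y)) ↔ ¬ Alternating (!ex) f := by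
  induction n generalizing ex with
  | zero => simp [Alternating]
  | succ n ih =>
    have fix_not (x : Fin (m 0) → Bool) :
        BoolFun.fix (m := m) (fun y => !(f y)) x = fun y => !(f.fix x y) := rfl
    cases ex <;> simp [Alternating, fix_not, ih]

theorem alternating_const {n : ℕ} {m : Fin n → ℕ} (ex c : Bool) :
    Alternating (m := m) ex (fun _ => c) ↔ c = true := by
  induction n generalizing ex with
  | zero => simp [Alternating]
  | succ n ih =>
    have fix_const (x : Fin (m 0) → Bool) :
        BoolFun.fix (m := m) (fun _ => c) x = fun _ => c := rfl
    cases ex <;> simp [Alternating, fix_const, ih]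

/-! ### Renaming and pinning variables -/

namespace BoolExpr

/-- Substitution of variables for variables. -/
def rename {V W : Type} (g : V → W) : BoolExpr V → BoolExpr W
  | var v => var (g v)
  | not e => not (e.rename g)
  | and e₁ e₂ => and (e₁.rename g) (e₂.rename g)
  | or e₁ e₂ => or (e₁.rename g) (e₂.rename g)

theorem eval_rename {V W : Type} (g : V → W) (ρ : W → Bool) (e : BoolExpr V) :
    (e.rename g).eval ρ = e.eval (fun v => ρ (g v)) := by
  induction e <;> simp_all [rename, eval]

variable {n : ℕ} {m : Fin (n + 1) → ℕ}

/-- The Boolean function in the remaining blocks that `e` describes once the first block is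
fixed to be `x`. -/
def slice (e : BoolExpr ((i : Fin (n + 1)) × Fin (m i))) (x : Fin (m 0) → Bool) :
    BoolFun (fun i : Fin n => m i.succ) :=
  fun y => e.eval (fun v => Fin.cons (α := fun i => Fin (m i) → Bool) x y v.1 v.2)

/-- The conjunction of `e` and the negations of the variables `a + 1, …, a + c` of the
first block. It forces the padding that follows an embedded shorter block to be zero. -/
def pins (e : BoolExpr ((i : Fin (n + 1)) × Fin (m i))) :
    (a c : ℕ) → a + c < m 0 → BoolExpr ((i : Fin (n + 1)) × Fin (m i))
  | _, 0, _ => e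
  | a, c + 1, h => and (not (var ⟨0, ⟨a + 1, by omega⟩⟩)) (e.pins (a + 1) c (by omega))

theorem slice_pins (e : BoolExpr ((i : Fin (n + 1)) × Fin (m i))) (a c : ℕ) (h : a + c < m 0)
    (x : Fin (m 0) → Bool) (y : (i : Fin n) → Fin (m i.succ) → Bool) :
    (e.pins a c h).slice x y =
      ((decide (∀ p : Fin (m 0), a < p → p ≤ a + c → x p = false)) && e.slice x y) := by
  induction c generalizing a with
  | zero =>
    have no_pins : ∀ p : Fin (m 0), a < p → p ≤ a + 0 → x p = false := fun p h₁ h₂ => by omega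
    simp only [pins, decide_eq_true no_pins, Bool.true_and]
  | succ c ih =>
    have slice_succ : (e.pins a (c + 1) h).slice x y =
      (!(x ⟨a + 1, by omega⟩) && (e.pins (a + 1) c (by omega)).slice x y) := rfl
    rw [slice_succ, ih, ← Bool.and_assoc]
    congr 1
    rw [Bool.eq_iff_iff]
    simp only [Bool.and_eq_true, Bool.not_eq_true', decide_eq_true_eq]
    refine ⟨?_, fun hx => ⟨hx _ (by simp) (by simp), fun p hp hp' => hx p (by omega) (by omega)⟩⟩
    rintro ⟨first, others⟩ p hp hp'
    rcases eq_or_ne (p : ℕ) (a + 1) with hpa | hpa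
    · rw [← first]
      exact congrArg x (Fin.ext hpa)
    · exact others p (by omega) (by omega)

theorem alternating_slice_pins (e : BoolExpr ((i : Fin (n + 1)) × Fin (m i))) {a c : ℕ}
    (h : a + c < m 0) (ex : Bool) (x : Fin (m 0) → Bool) :
    Alternating ex ((e.pins a c h).slice x) ↔
      (∀ p : Fin (m 0), a < p → p ≤ a + c → x p = false) ∧ Alternating ex (e.slice x) := by
  rw [funext (slice_pins e a c h x)]
  by_cases pinned : ∀ p : Fin (m 0), a < p → p ≤ a + c → x p = false
  · simp only [eq_true pinned, decide_true, Bool.true_and, true_and]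
  · simp only [eq_false pinned, decide_false, Bool.false_and, alternating_const,
      Bool.false_eq_true, false_and]

end BoolExpr

/-! ### Embedding the blocks of an input into longer ones -/

/-- The number of variables that are put in front of the `i`-th block: one for the first block,
none for the others. -/
def offset {n : ℕ} (i : Fin (n + 1)) : ℕ := if i = 0 then 1 else 0

/-- The embedding of blocks into longer ones that leaves room for `offset` variables. -/
def shiftVar {n : ℕ} {m M : Fin (n + 1) → ℕ} (h : ∀ i, m i + offset i ≤ M i)
    (v : (i : Fin (n + 1)) × Fin (m i)) : (i : Fin (n + 1)) × Fin (M i) :=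
  ⟨v.1, ⟨v.2 + offset v.1, by have := h v.1; omega⟩⟩

/-- The assignment in `Σ^M` that consists of the letter `c`, the word `z`, and zeros. -/
def pad {k M : ℕ} (c : Bool) (z : Fin k → Bool) : Fin M → Bool :=
  fun p => if (p : ℕ) = 0 then c else if h : (p : ℕ) - 1 < k then z ⟨p - 1, h⟩ else false

/-- The letters `1, …, k` of an assignment: what is left of `pad` without its first letter and
its zeros. -/
def unpad {k M : ℕ} (h : k + 1 ≤ M) (x : Fin M → Bool) : Fin k → Bool :=
  fun j => x ⟨j + 1, by omega⟩

theorem pad_zero {k M : ℕ} (h : 0 < M) (c : Bool) (z : Fin k → Bool) :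
    pad c z (⟨0, h⟩ : Fin M) = c := by
  simp [pad]

theorem eq_pad_iff {k M : ℕ} (h : k + 1 ≤ M) (c : Bool) (z : Fin k → Bool) (x : Fin M → Bool) :
    x = pad c z ↔ x ⟨0, by omega⟩ = c ∧ (∀ p : Fin M, k < p → x p = false) ∧ unpad h x = z := by
  constructor
  · rintro rfl
    refine ⟨pad_zero _ c z, fun p hp => ?_, ?_⟩
    · rw [pad, if_neg (by omega), dif_neg (by omega)]
    · funext j
      simp [pad, unpad]
  · rintro ⟨first, zeros, rfl⟩
    funext p
    simp only [pad, unpad]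
    split_ifs with hp hpk
    · rw [← first]
      exact congrArg x (Fin.ext hp)
    · exact congrArg x (Fin.ext (by simp; omega))
    · exact zeros p (by omega)

namespace Input

variable {n : ℕ}

theorem alternating_slice_rename (F : Input n) {M : Fin (n + 1) → ℕ}
    (h : ∀ i, F.m i + offset i ≤ M i) (ex : Bool) (x : Fin (M 0) → Bool) :
    Alternating ex ((F.expr.rename (shiftVar h)).slice x) ↔
      Alternating ex (F.fn.fix (unpad (h 0) x)) := by
  have hle (i : Fin n) : F.m i.succ ≤ M i.succ := (Nat.le_add_right _ _).trans (h i.succ)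
  rw [← alternating_comp (fun i (y : Fin (M i.succ) → Bool) j => y (Fin.castLE (hle i) j))]
  · refine iff_of_eq (congrArg _ (funext fun y => ?_))
    simp only [BoolExpr.slice, BoolExpr.eval_rename, BoolFun.fix, fn]
    refine congrArg (fun ρ => F.expr.eval ρ) (funext fun ⟨i, j⟩ => ?_)
    cases i using Fin.cases <;> rfl
  · intro i z
    refine ⟨fun p => if hp : (p : ℕ) < F.m i.succ then z ⟨p, hp⟩ else false, ?_⟩
    funext j
    simp

/-- The numbers of variables of `combine F G`. -/
def size (F G : Input n) (i : Fin (n + 1)) : ℕ := F.m i + G.m i + offset i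

theorem size_zero (F G : Input n) : size F G 0 = F.m 0 + G.m 0 + 1 := rfl

theorem left_le_size (F G : Input n) (i : Fin (n + 1)) : F.m i + offset i ≤ size F G i := by
  simp only [size]; omega

theorem right_le_size (F G : Input n) (i : Fin (n + 1)) : G.m i + offset i ≤ size F G i := by
  simp only [size]; omega

/-- The expression of `F`, in the variables of `combine F G`. -/
def left (F G : Input n) : BoolExpr ((i : Fin (n + 1)) × Fin (size F G i)) :=
  F.expr.rename (shiftVar (left_le_size F G))

/-- The expression of `G`, in the variables of `combine F G`. -/
def right (F G : Input n) : BoolExpr ((i : Fin (n + 1)) × Fin (size F G i)) :=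
  G.expr.rename (shiftVar (right_le_size F G))

/-- The function whose witnesses are `1 x 0…0` for the witnesses `x` of `F` and
`0 y 0…0` for the counterexamples `y` of `G`. -/
abbrev combine (F G : Input n) : Input n where
  m := size F G
  pos := by simp only [size_zero]; omega
  expr :=
    .or
      (.and (.var ⟨0, ⟨0, by simp only [size_zero]; omega⟩⟩)
        ((left F G).pins (F.m 0) (G.m 0) (by simp only [size_zero]; omega)))
      (.and (.not (.var ⟨0, ⟨0, by simp only [size_zero]; omega⟩⟩))
        ((right F G).not.pins (G.m 0) (F.m 0) (by simp only [size_zero]; omega)))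

/-- The function whose witnesses are those of `F` that begin with `1`. -/
abbrev selectOne (F : Input n) : Input n where
  m := F.m
  pos := F.pos
  expr := .and (.var ⟨0, ⟨0, F.pos⟩⟩) F.expr

/-- The function whose counterexamples are the witnesses of `F` that begin with `0`. -/
abbrev selectZero (F : Input n) : Input n where
  m := F.m
  pos := F.pos
  expr := .or (.var ⟨0, ⟨0, F.pos⟩⟩) (.not F.expr)

theorem coSAT_combine_fix (F G : Input n) (x : Fin (size F G 0) → Bool) :
    CoSAT ((combine F G).fn.fix x) ↔
      (∃ z, x = pad true z ∧ CoSAT (F.fn.fix z)) ∨ ∃ z, x = pad false z ∧ ¬ SAT (G.fn.fix z) := by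
  have hp (p : Fin (size F G 0)) : (p : ℕ) ≤ F.m 0 + G.m 0 := Nat.le_of_lt_succ p.2
  have hp' (p : Fin (size F G 0)) : (p : ℕ) ≤ G.m 0 + F.m 0 := by have := hp p; omega
  have coSAT_left : Alternating false ((left F G).slice x) ↔
      CoSAT (F.fn.fix (unpad (left_le_size F G 0) x)) :=
    alternating_slice_rename F (left_le_size F G) false x
  have sat_right : Alternating true ((right F G).slice x) ↔
      SAT (G.fn.fix (unpad (right_le_size F G 0) x)) :=
    alternating_slice_rename G (right_le_size F G) true x
  have alternating_not_right : Alternating false ((right F G).not.slice x) ↔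
      ¬ Alternating true ((right F G).slice x) := alternating_not false _
  have coSAT_iff : CoSAT ((combine F G).fn.fix x) ↔
      Alternating (n := n) (m := fun i => size F G i.succ) false fun y =>
        x ⟨0, (combine F G).pos⟩ &&
            ((left F G).pins (F.m 0) (G.m 0) (by rw [size_zero]; omega)).slice x y ||
          !x ⟨0, (combine F G).pos⟩ &&
            ((right F G).not.pins (G.m 0) (F.m 0) (by rw [size_zero]; omega)).slice x y := Iff.rfl
  simp only [eq_pad_iff (left_le_size F G 0), eq_pad_iff (right_le_size F G 0), coSAT_iff]
  cases x ⟨0, (combine F G).pos⟩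
  · simp [BoolExpr.alternating_slice_pins, hp', alternating_not_right, sat_right]
  · simp [BoolExpr.alternating_slice_pins, hp, coSAT_left]

theorem coSAT_selectOne_fix (F : Input n) (x : Fin (F.m 0) → Bool) :
    CoSAT ((selectOne F).fn.fix x) ↔ x ⟨0, F.pos⟩ = true ∧ CoSAT (F.fn.fix x) := by
  have coSAT_iff : CoSAT ((selectOne F).fn.fix x) ↔
      Alternating (n := n) (m := fun i => F.m i.succ) false fun y =>
        x ⟨0, F.pos⟩ && F.fn.fix x y := Iff.rfl
  rw [coSAT_iff]
  cases x ⟨0, F.pos⟩ <;> simp [alternating_const, CoSAT]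

theorem not_SAT_selectZero_fix (F : Input n) (x : Fin (F.m 0) → Bool) :
    ¬ SAT ((selectZero F).fn.fix x) ↔ x ⟨0, F.pos⟩ = false ∧ CoSAT (F.fn.fix x) := by
  have sat_iff : SAT ((selectZero F).fn.fix x) ↔
      Alternating (n := n) (m := fun i => F.m i.succ) true fun y =>
        x ⟨0, F.pos⟩ || !F.fn.fix x y := Iff.rfl
  rw [sat_iff]
  cases x ⟨0, F.pos⟩ <;> simp [alternating_const, alternating_not, CoSAT]

end Input

/-! ### Valid answers -/

theorem promise_of_true {P : Prop} (h : P) {s : Set Bool} (hs : P → s.Nonempty) :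
    (promise P s hs).1 = s := by
  simp [promise, h]

theorem promise_of_false {P : Prop} (h : ¬ P) {s : Set Bool} (hs : P → s.Nonempty) :
    (promise P s hs).1 = Set.univ := by
  simp [promise, h, anyAnswer]

theorem promise_subset_iff {P : Prop} {s S : Set Bool} {hs : P → s.Nonempty}
    (hS : S ≠ Set.univ) : (promise P s hs).1 ⊆ S ↔ P ∧ s ⊆ S := by
  by_cases h : P
  · simp [promise_of_true, h]
  · simpa [promise_of_false, h, -Bool.univ_eq] using mt Set.univ_subset_iff.1 hS

theorem truth_of_true {P : Prop} (h : P) : truth P = true := by simp [truth, h]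

theorem truth_of_false {P : Prop} (h : ¬ P) : truth P = false := by simp [truth, h]

namespace Input

variable {n : ℕ}

theorem uval_eq_singleton {F : Input n} {z : Fin (F.m 0) → Bool}
    (h : ∀ x, CoSAT (F.fn.fix x) ↔ x = z) : F.uval.1 = {z ⟨0, F.pos⟩} := by
  rw [uval, promise_of_true ⟨z, (h z).2 rfl, fun x hx => (h x).1 hx⟩]
  simp [h]

theorem uval_combine_of_left {F G : Input n} {z : Fin (F.m 0) → Bool}
    (hF : ∀ x, CoSAT (F.fn.fix x) ↔ x = z) (hG : CoSAT G.fn) :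
    (combine F G).uval.1 = {true} := by
  have witness (x) : CoSAT ((combine F G).fn.fix x) ↔ x = pad true z :=
    (coSAT_combine_fix F G x).trans (by simp [hF, (coSAT_succ _).1 hG])
  rw [uval_eq_singleton witness, pad_zero]

theorem uval_combine_of_right {F G : Input n} {z : Fin (G.m 0) → Bool}
    (hF : ¬ SAT F.fn) (hG : ∀ x, ¬ SAT (G.fn.fix x) ↔ x = z) :
    (combine F G).uval.1 = {false} := by
  have hF' (x) : ¬ CoSAT (F.fn.fix x) := fun hx => hF ((sat_succ _).2 ⟨x, hx⟩)
  have witness (x) : CoSAT ((combine F G).fn.fix x) ↔ x = pad false z :=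
    (coSAT_combine_fix F G x).trans (by simp [hF', hG])
  rw [uval_eq_singleton witness, pad_zero]

theorem uval_combine_subset {F G : Input n} {S : Set Bool} (hF : F.usat.1 ⊆ S)
    (hG : G.coUsat.1 ⊆ S) : (combine F G).uval.1 ⊆ S := by
  rcases eq_or_ne S Set.univ with rfl | hS
  · exact Set.subset_univ _
  obtain ⟨uniqueF, answerF⟩ := (promise_subset_iff hS).1 hF
  obtain ⟨uniqueG, answerG⟩ := (promise_subset_iff hS).1 hG
  rw [Set.singleton_subset_iff] at answerF answerG
  rw [Set.ncard_le_one_iff_subsingleton] at uniqueF uniqueG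
  by_cases satF : SAT F.fn <;> by_cases coSatG : CoSAT G.fn
  · obtain ⟨z, hz⟩ := (sat_succ _).1 satF
    rw [uval_combine_of_left (fun x => ⟨fun hx => uniqueF hx hz, fun h => h ▸ hz⟩) coSatG]
    rwa [truth_of_true satF, ← Set.singleton_subset_iff] at answerF
  · rw [truth_of_true satF] at answerF
    rw [truth_of_false coSatG] at answerG
    exact absurd (Set.eq_univ_of_forall (Bool.rec answerG answerF)) hS
  · rw [truth_of_false satF] at answerF
    rw [truth_of_true coSatG] at answerG
    exact absurd (Set.eq_univ_of_forall (Bool.rec answerF answerG)) hS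
  · obtain ⟨z, hz⟩ := not_forall.1 (mt (coSAT_succ _).2 coSatG)
    rw [uval_combine_of_right satF fun x => ⟨fun hx => uniqueG hx hz, fun h => h ▸ hz⟩]
    rwa [truth_of_false coSatG, ← Set.singleton_subset_iff] at answerG

theorem usat_selectOne_subset_uval (F : Input n) : (selectOne F).usat.1 ⊆ F.uval.1 := by
  by_cases unique : ∃! x, CoSAT (F.fn.fix x)
  · obtain ⟨z, hz, hu⟩ := unique
    have witnesses (x) : CoSAT ((selectOne F).fn.fix x) ↔ z ⟨0, F.pos⟩ = true ∧ x = z := by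
      rw [coSAT_selectOne_fix]
      exact ⟨fun ⟨h₁, h₂⟩ => hu x h₂ ▸ ⟨h₁, rfl⟩, fun ⟨h₁, h₂⟩ => h₂ ▸ ⟨h₁, hz⟩⟩
    rw [uval_eq_singleton fun x => ⟨hu x, fun h => h ▸ hz⟩, usat, promise_of_true, sat_succ]
    · simp [witnesses, truth]
    · exact Set.ncard_le_one_iff_subsingleton.2 fun x hx y hy =>
        ((witnesses x).1 hx).2.trans ((witnesses y).1 hy).2.symm
  · rw [uval, promise_of_false unique]
    exact Set.subset_univ _

theorem coUsat_selectZero_subset_uval (F : Input n) : (selectZero F).coUsat.1 ⊆ F.uval.1 := by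
  by_cases unique : ∃! x, CoSAT (F.fn.fix x)
  · obtain ⟨z, hz, hu⟩ := unique
    have counterexamples (x) :
        ¬ SAT ((selectZero F).fn.fix x) ↔ z ⟨0, F.pos⟩ = false ∧ x = z := by
      rw [not_SAT_selectZero_fix]
      exact ⟨fun ⟨h₁, h₂⟩ => hu x h₂ ▸ ⟨h₁, rfl⟩, fun ⟨h₁, h₂⟩ => h₂ ▸ ⟨h₁, hz⟩⟩
    rw [uval_eq_singleton fun x => ⟨hu x, fun h => h ▸ hz⟩, coUsat, promise_of_true, coSAT_succ]
    · simp only [← not_exists_not, counterexamples]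
      simp [truth]
    · exact Set.ncard_le_one_iff_subsingleton.2 fun x hx y hy =>
        ((counterexamples x).1 hx).2.trans ((counterexamples y).1 hy).2.symm
  · rw [uval, promise_of_false unique]
    exact Set.subset_univ _

end Input

section StackMachines

open Turing (TM2.Stmt TM2.Cfg TM2.step TM2.stepAux FinTM2)
open Turing.TM2.Stmt

/-! ### Timed runs of stack machines -/

/-- `ReachesIn f t a b`: iterating the partial function `f` leads from `a` to `b` in at most `t`
steps. -/
inductive ReachesIn {C : Type*} (f : C → Option C) : ℕ → C → C → Prop
  | refl (t : ℕ) (c : C) : ReachesIn f t c c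
  | head {t : ℕ} {a b c : C} : f a = some b → ReachesIn f t b c → ReachesIn f (t + 1) a c

namespace ReachesIn

variable {C D : Type*} {f : C → Option C} {g : D → Option D} {s t : ℕ} {a b c : C}

theorem trans (hab : ReachesIn f s a b) (hbc : ReachesIn f t b c) : ReachesIn f (s + t) a c := by
  induction hab with
  | refl s a =>
    induction hbc generalizing s with
    | refl t c => exact refl _ c
    | head h _ ih => exact head h (ih s)
  | head h _ ih => rw [Nat.add_right_comm]; exact head h (ih hbc)

theorem mono (h : ReachesIn f s a b) (hst : s ≤ t) : ReachesIn f t a b := by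
  obtain ⟨k, rfl⟩ := Nat.exists_eq_add_of_le hst
  exact h.trans (refl k b)

theorem exists_of_simulation {R : C → D → Prop}
    (hstep : ∀ ⦃a b d⦄, R a d → f a = some b → ∃ e, g d = some e ∧ R b e)
    (h : ReachesIn f t a b) {d : D} (hd : R a d) : ∃ e, ReachesIn g t d e ∧ R b e := by
  induction h generalizing d with
  | refl t a => exact ⟨d, refl t d, hd⟩
  | head hab _ ih =>
    obtain ⟨e, hde, he⟩ := hstep hd hab
    obtain ⟨e', hee', he'⟩ := ih he
    exact ⟨e', head hde hee', he'⟩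

theorem of_evalsToInTime (h : StateTransition.EvalsToInTime f a (some b) t) :
    ReachesIn f t a b := by
  suffices ∀ n a, (flip bind f)^[n] (some a) = some b → ReachesIn f n a b from
    (this _ a h.evals_in_steps).mono h.steps_le_m
  intro n
  induction n with
  | zero => rintro a h; obtain rfl := Option.some.inj h; exact refl 0 a
  | succ n ih =>
    intro a h
    rw [Function.iterate_succ_apply] at h
    cases hfa : f a with
    | none =>
      have hnone : (flip bind f)^[n] none = none := Function.iterate_fixed rfl n
      have : flip bind f (some a) = none := hfa
      rw [this, hnone] at h
      cases h
    | some a' =>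
      have : flip bind f (some a) = some a' := hfa
      exact head hfa (ih a' (this ▸ h))

theorem nonempty_evalsToInTime (h : ReachesIn f t a b) :
    Nonempty (StateTransition.EvalsToInTime f a (some b) t) := by
  induction h with
  | refl t c => exact ⟨⟨⟨0, rfl⟩, Nat.zero_le t⟩⟩
  | head hab _ ih =>
    obtain ⟨e⟩ := ih
    exact ⟨⟨⟨e.steps + 1, (congrArg (flip bind f)^[e.steps] hab).trans e.evals_in_steps⟩,
      Nat.succ_le_succ e.steps_le_m⟩⟩

end ReachesIn

/-- The contents of the stacks of a machine whose stack `k` has the alphabet `Γ k`. -/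
abbrev Store {K : Type} (Γ : K → Type) : Type := ∀ k, List (Γ k)

/-- A program for the stacks `Γ`, in Mathlib's model of multi-stack machines. Its initial internal
state is also the one in which it has to halt, so that programs can be chained. -/
structure Routine {K : Type} (Γ : K → Type) where
  {Λ σ : Type}
  [finΛ : Fintype Λ]
  [finσ : Fintype σ]
  entry : Λ
  initial : σ
  stmt : Λ → TM2.Stmt Γ Λ σ

attribute [instance] Routine.finΛ Routine.finσ

section Routines

variable {K : Type} [DecidableEq K] {Γ : K → Type}

namespace Routine

/-- The routine leads from the store `S` to the store `S'` in at most `t` steps. -/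
def Runs (R : Routine Γ) (t : ℕ) (S S' : Store Γ) : Prop :=
  ReachesIn (TM2.step R.stmt) t ⟨some R.entry, R.initial, S⟩ ⟨none, R.initial, S'⟩

end Routine

/-! ### Sequential composition and loops -/

section Lift

variable {Λ₁ σ₁ Λ σ τ : Type} (ε : σ ≃ σ₁ × τ) (ℓ : Λ₁ → Λ) (exit : Option Λ)

/-- A statement as part of a larger program: its internal state is the component `σ₁` of the state
of the program, its labels are renamed by `ℓ`, and instead of halting it goes to `exit`. -/
def liftStmt : TM2.Stmt Γ Λ₁ σ₁ → TM2.Stmt Γ Λ σ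
  | push k f q => push k (fun v => f (ε v).1) (liftStmt q)
  | peek k f q => peek k (fun v x => ε.symm (f (ε v).1 x, (ε v).2)) (liftStmt q)
  | pop k f q => pop k (fun v x => ε.symm (f (ε v).1 x, (ε v).2)) (liftStmt q)
  | load f q => load (fun v => ε.symm (f (ε v).1, (ε v).2)) (liftStmt q)
  | branch p q₁ q₂ => branch (fun v => p (ε v).1) (liftStmt q₁) (liftStmt q₂)
  | goto l => goto fun v => ℓ (l (ε v).1)
  | halt => exit.elim halt fun l => goto fun _ => l

/-- The configuration of the larger program that corresponds to `c`. -/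
def liftCfg (w : τ) (c : TM2.Cfg Γ Λ₁ σ₁) : TM2.Cfg Γ Λ σ :=
  ⟨c.l.elim exit fun l => some (ℓ l), ε.symm (c.var, w), c.stk⟩

theorem stepAux_liftStmt (q : TM2.Stmt Γ Λ₁ σ₁) (v : σ₁) (w : τ) (S : Store Γ) :
    TM2.stepAux (liftStmt ε ℓ exit q) (ε.symm (v, w)) S =
      liftCfg ε ℓ exit w (TM2.stepAux q v S) := by
  induction q generalizing v S with
  | branch p q₁ q₂ ih₁ ih₂ => cases h : p v <;> simp [liftStmt, h, ih₁, ih₂]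
  | goto l => simp [liftStmt, liftCfg]
  | halt => cases exit <;> simp [liftStmt, liftCfg]
  | _ => simp [liftStmt, *]

theorem ReachesIn.lift {M₁ : Λ₁ → TM2.Stmt Γ Λ₁ σ₁} {M : Λ → TM2.Stmt Γ Λ σ}
    (hM : ∀ l, M (ℓ l) = liftStmt ε ℓ exit (M₁ l)) {t : ℕ} {a b : TM2.Cfg Γ Λ₁ σ₁}
    (h : ReachesIn (TM2.step M₁) t a b) (w : τ) :
    ReachesIn (TM2.step M) t (liftCfg ε ℓ exit w a) (liftCfg ε ℓ exit w b) := by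
  obtain ⟨_, hrun, rfl⟩ := h.exists_of_simulation (g := TM2.step M)
    (R := fun c d => d = liftCfg ε ℓ exit w c) (by
      rintro ⟨_ | l, v, S⟩ b _ rfl hb
      · cases hb
      · obtain rfl := Option.some.inj hb
        exact ⟨_, congrArg some (by rw [hM, stepAux_liftStmt]), rfl⟩) rfl
  exact hrun

end Lift

namespace Routine

/-- Runs `R₁` and then `R₂`. -/
def seq (R₁ R₂ : Routine Γ) : Routine Γ where
  Λ := R₁.Λ ⊕ R₂.Λ
  σ := R₁.σ × R₂.σ
  entry := .inl R₁.entry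
  initial := (R₁.initial, R₂.initial)
  stmt
    | .inl l => liftStmt (.refl _) .inl (some (.inr R₂.entry)) (R₁.stmt l)
    | .inr l => liftStmt (.prodComm _ _) .inr none (R₂.stmt l)

theorem Runs.seq {R₁ R₂ : Routine Γ} {t₁ t₂ : ℕ} {S₁ S₂ S₃ : Store Γ} (h₁ : R₁.Runs t₁ S₁ S₂)
    (h₂ : R₂.Runs t₂ S₂ S₃) : (R₁.seq R₂).Runs (t₁ + t₂) S₁ S₃ := by
  have first := ReachesIn.lift (M := (R₁.seq R₂).stmt) (.refl _) .inl (some (.inr R₂.entry))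
    (fun _ => rfl) h₁ R₂.initial
  have second := ReachesIn.lift (M := (R₁.seq R₂).stmt) (.prodComm _ _) .inr none
    (fun _ => rfl) h₂ R₁.initial
  exact first.trans second

/-- Runs `R` as long as a symbol can be popped from the stack `k`. -/
def loop (k : K) (R : Routine Γ) : Routine Γ where
  Λ := Option R.Λ
  σ := R.σ × Bool
  entry := none
  initial := (R.initial, false)
  stmt
    | none => pop k (fun v x => (v.1, x.isSome)) <| branch Prod.snd
        (load (fun v => (v.1, false)) <| goto fun _ => some R.entry) halt
    | some l => liftStmt (.refl _) some (some none) (R.stmt l)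

theorem Runs.loop {R : Routine Γ} {k : K} {t : ℕ} {I : ℕ → Store Γ}
    (hlength : ∀ j, (I j k).length = j) (N : ℕ)
    (hbody : ∀ j < N, R.Runs t (Function.update (I (j + 1)) k (I (j + 1) k).tail) (I j)) :
    (R.loop k).Runs ((t + 1) * N + 1) (I N) (I 0) := by
  induction N with
  | zero =>
    have hk : I 0 k = [] := List.length_eq_zero_iff.1 (hlength 0)
    refine .head (congrArg some ?_) (.refl _ _)
    simp [Routine.loop, hk, Function.update_eq_self_iff]
  | succ N ih =>
    obtain ⟨x, xs, hk⟩ := List.exists_cons_of_length_eq_add_one (hlength (N + 1))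
    have hpop : TM2.step (R.loop k).stmt ⟨some none, (R.initial, false), I (N + 1)⟩ =
        some ⟨some (some R.entry), (R.initial, false),
          Function.update (I (N + 1)) k (I (N + 1) k).tail⟩ := by
      simp [TM2.step, Routine.loop, hk]
    have hrun := ReachesIn.lift (M := (R.loop k).stmt) (.refl _) some (some none)
      (fun _ => rfl) (hbody N N.lt_succ_self) false
    exact (ReachesIn.head hpop (hrun.trans (ih fun j hj => hbody j (hj.trans N.lt_succ_self)))).mono
      (by rw [mul_add]; omega)

end Routine

/-! ### Adding stacks -/

section Embed

variable {K₁ : Type} {Λ σ : Type} {e : K₁ → K}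

/-- A statement for the stacks `e k` as a statement for all stacks. -/
def embedStmt (e : K₁ → K) : TM2.Stmt (fun k => Γ (e k)) Λ σ → TM2.Stmt Γ Λ σ
  | push k f q => push (e k) f (embedStmt e q)
  | peek k f q => peek (e k) f (embedStmt e q)
  | pop k f q => pop (e k) f (embedStmt e q)
  | load f q => load f (embedStmt e q)
  | branch p q₁ q₂ => branch p (embedStmt e q₁) (embedStmt e q₂)
  | goto l => goto l
  | halt => halt

/-- The part of a configuration that concerns the stacks `e k`. -/
def restrictCfg (e : K₁ → K) (c : TM2.Cfg Γ Λ σ) : TM2.Cfg (fun k => Γ (e k)) Λ σ :=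
  ⟨c.l, c.var, fun k => c.stk (e k)⟩

theorem restrictCfg_stepAux_embedStmt [DecidableEq K₁] (he : e.Injective)
    (q : TM2.Stmt (fun k => Γ (e k)) Λ σ) (v : σ) (S : Store Γ) :
    restrictCfg e (TM2.stepAux (embedStmt e q) v S) = TM2.stepAux q v fun k => S (e k) := by
  have hupdate : ∀ (S : Store Γ) k x, (fun i => Function.update S (e k) x (e i)) =
      Function.update (fun i => S (e i)) k x := fun S k x =>
    funext fun i => Function.update_apply_of_injective S he k x i
  induction q generalizing v S with
  | branch p q₁ q₂ ih₁ ih₂ => cases h : p v <;> simp [embedStmt, h, ih₁, ih₂]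
  | goto | halt => rfl
  | _ => simp [embedStmt, *]

theorem stepAux_embedStmt_stk_of_notMem (q : TM2.Stmt (fun k => Γ (e k)) Λ σ) (v : σ)
    (S : Store Γ) {i : K} (hi : i ∉ Set.range e) :
    (TM2.stepAux (embedStmt e q) v S).stk i = S i := by
  have hne : ∀ k, i ≠ e k := fun k h => hi ⟨k, h.symm⟩
  induction q generalizing v S with
  | branch p q₁ q₂ ih₁ ih₂ => cases h : p v <;> simp [embedStmt, h, ih₁, ih₂]
  | goto | halt => rfl
  | _ => simp [embedStmt, *]

namespace Routine

/-- A routine for the stacks `e k` as a routine for all stacks. -/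
def embed (e : K₁ → K) (R : Routine fun k => Γ (e k)) : Routine Γ where
  entry := R.entry
  initial := R.initial
  stmt l := embedStmt e (R.stmt l)

theorem Runs.embed [DecidableEq K₁] (he : e.Injective) {R : Routine fun k => Γ (e k)} {t : ℕ}
    {S S' : Store Γ} (h : R.Runs t (fun k => S (e k)) fun k => S' (e k))
    (hS : ∀ i ∉ Set.range e, S' i = S i) :
    (R.embed e).Runs t S S' := by
  obtain ⟨⟨l, v, T⟩, hrun, hd, hT⟩ := h.exists_of_simulation (g := TM2.step (R.embed e).stmt)
    (R := fun c d => restrictCfg e d = c ∧ ∀ i ∉ Set.range e, d.stk i = S i) (by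
      rintro _ b ⟨_ | l, v, T⟩ ⟨rfl, hT⟩ hb
      · cases hb
      · obtain rfl := Option.some.inj hb
        exact ⟨_, rfl, restrictCfg_stepAux_embedStmt he _ v T, fun i hi =>
          (stepAux_embedStmt_stk_of_notMem _ v T hi).trans (hT i hi)⟩)
    (d := ⟨some R.entry, R.initial, S⟩) ⟨rfl, fun _ _ => rfl⟩
  obtain ⟨rfl, rfl, hT'⟩ := TM2.Cfg.mk.inj hd
  suffices T = S' from this ▸ hrun
  funext i
  by_cases hi : i ∈ Set.range e
  · obtain ⟨k, rfl⟩ := hi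
    exact congrFun hT' k
  · exact (hT i hi).trans (hS i hi).symm

end Routine

end Embed

end Routines

/-! ### Transformations of the stacks in polynomial time -/

section Transformations

variable {K : Type} {Γ : K → Type} [Fintype K]

/-- The length of the longest stack, the measure of size for time bounds. -/
def Store.size (S : Store Γ) : ℕ := Finset.univ.sup fun k => (S k).length

theorem Store.length_le_size (S : Store Γ) (k : K) : (S k).length ≤ S.size :=
  Finset.le_sup (f := fun k => (S k).length) (Finset.mem_univ k)

theorem Store.size_le_iff {S : Store Γ} {n : ℕ} : S.size ≤ n ↔ ∀ k, (S k).length ≤ n := by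
  simp [Store.size]

variable [DecidableEq K]

theorem Store.size_update_le {S : Store Γ} {n : ℕ} (hS : S.size ≤ n) {k : K} {w : List (Γ k)}
    (hw : w.length ≤ n) : Store.size (Function.update S k w) ≤ n := by
  refine size_le_iff.2 fun i => ?_
  rcases eq_or_ne i k with rfl | hi
  · simpa using hw
  · simpa [hi] using size_le_iff.1 hS i

/-- The largest number of symbols that a statement pushes. -/
def maxPushes {Λ σ : Type} : TM2.Stmt Γ Λ σ → ℕ
  | push _ _ q => maxPushes q + 1
  | peek _ _ q => maxPushes q
  | pop _ _ q => maxPushes q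
  | load _ q => maxPushes q
  | branch _ q₁ q₂ => max (maxPushes q₁) (maxPushes q₂)
  | goto _ => 0
  | halt => 0

theorem size_stepAux_le {Λ σ : Type} (q : TM2.Stmt Γ Λ σ) (v : σ) (S : Store Γ) :
    Store.size (TM2.stepAux q v S).stk ≤ S.size + maxPushes q := by
  induction q generalizing v S with
  | push k f q ih =>
    have hS : Store.size (Function.update S k (f v :: S k)) ≤ S.size + 1 :=
      Store.size_update_le (Nat.le_succ _) (Nat.succ_le_succ (S.length_le_size k))
    exact (ih v _).trans (by simp only [maxPushes]; omega)
  | peek _ _ _ ih => exact ih _ _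
  | pop k f q ih =>
    have hS : Store.size (Function.update S k (S k).tail) ≤ S.size :=
      Store.size_update_le le_rfl
        (List.length_tail.trans_le ((Nat.sub_le _ _).trans (S.length_le_size k)))
    exact (ih _ _).trans (Nat.add_le_add_right hS _)
  | load _ _ ih => exact ih _ _
  | branch p q₁ q₂ ih₁ ih₂ =>
    cases h : p v
    · simpa [h, maxPushes] using (ih₂ v S).trans (Nat.add_le_add_left (le_max_right _ _) _)
    · simpa [h, maxPushes] using (ih₁ v S).trans (Nat.add_le_add_left (le_max_left _ _) _)
  | goto | halt => exact Nat.le_add_right _ _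

theorem Routine.exists_size_le (R : Routine Γ) :
    ∃ c, ∀ {t S S'}, R.Runs t S S' → S'.size ≤ S.size + c * t := by
  let c := Finset.univ.sup fun l => maxPushes (R.stmt l)
  refine ⟨c, fun {t S S'} h => ?_⟩
  suffices ∀ {a b}, ReachesIn (TM2.step R.stmt) t a b →
      Store.size b.stk ≤ Store.size a.stk + c * t from this h
  intro a b hab
  clear h
  induction hab with
  | refl => exact Nat.le_add_right _ _
  | @head t a _ _ hstep _ ih =>
    obtain ⟨_ | l, v, S⟩ := a
    · cases hstep
    · obtain rfl := Option.some.inj hstep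
      have hl : maxPushes (R.stmt l) ≤ c :=
        Finset.le_sup (f := fun l => maxPushes (R.stmt l)) (Finset.mem_univ l)
      have hone : Store.size (TM2.stepAux (R.stmt l) v S).stk ≤ Store.size S + c :=
        (size_stepAux_le (R.stmt l) v S).trans (Nat.add_le_add_left hl _)
      exact ih.trans ((Nat.add_le_add_right hone _).trans_eq (by ring))

theorem monotone_eval (p : Polynomial ℕ) : Monotone fun n => p.eval n := fun a b h => by
  simp only [Polynomial.eval_eq_sum_range]
  gcongr

/-- One routine leads from the store `P a` to the store `Q a` for every `a`, in time polynomial in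
the size of `P a`. -/
def Transforms {A : Type*} (P Q : A → Store Γ) : Prop :=
  ∃ (R : Routine Γ) (p : Polynomial ℕ), ∀ a, R.Runs (p.eval (P a).size) (P a) (Q a)

namespace Transforms

variable {A B : Type*} {P Q T : A → Store Γ}

theorem congr_left (h : Transforms P Q) (hPT : ∀ a, P a = T a) : Transforms T Q := funext hPT ▸ h

theorem congr_right (h : Transforms P Q) (hQT : ∀ a, Q a = T a) : Transforms P T := funext hQT ▸ h

theorem comap (h : Transforms P Q) (f : B → A) : Transforms (P ∘ f) (Q ∘ f) :=
  let ⟨R, p, hR⟩ := h; ⟨R, p, fun b => hR (f b)⟩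

theorem trans (h₁ : Transforms P Q) (h₂ : Transforms Q T) : Transforms P T := by
  obtain ⟨R₁, p₁, h₁⟩ := h₁
  obtain ⟨R₂, p₂, h₂⟩ := h₂
  obtain ⟨c, hc⟩ := R₁.exists_size_le
  refine ⟨R₁.seq R₂, p₁ + p₂.comp (X + C c * p₁), fun a => ?_⟩
  simpa using (h₁ a).seq ((h₂ a).mono (monotone_eval p₂ (hc (h₁ a))))

theorem loop {I : A → ℕ → Store Γ} {N : A → ℕ} {k : K}
    (hlength : ∀ a j, (I a j k).length = j)
    (hbody : Transforms
      (fun x : {x : A × ℕ // x.2 < N x.1} =>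
        Function.update (I x.1.1 (x.1.2 + 1)) k (I x.1.1 (x.1.2 + 1) k).tail)
      fun x => I x.1.1 x.1.2)
    (p : Polynomial ℕ)
    (hsize : ∀ a, ∀ j ≤ N a, (I a j).size ≤ p.eval (I a (N a)).size) :
    Transforms (fun a => I a (N a)) fun a => I a 0 := by
  obtain ⟨R, r, hR⟩ := hbody
  refine ⟨R.loop k, (r.comp p + 1) * X + 1, fun a => ?_⟩
  have hN : N a ≤ (I a (N a)).size := (hlength a (N a)).ge.trans (Store.length_le_size _ k)
  have hrun := Routine.Runs.loop (t := r.eval (p.eval (I a (N a)).size)) (hlength a) (N a)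
    fun j hj => (hR ⟨(a, j), hj⟩).mono <| monotone_eval r <| Store.size_update_le (hsize a _ hj) <|
      List.length_tail.trans_le <|
        (Nat.sub_le _ _).trans <| (Store.length_le_size _ k).trans (hsize a _ hj)
  refine hrun.mono ?_
  simp only [Polynomial.eval_add, Polynomial.eval_mul, Polynomial.eval_comp, Polynomial.eval_one,
    Polynomial.eval_X]
  gcongr

theorem embed {K₁ : Type} [DecidableEq K₁] [Fintype K₁] {e : K₁ → K} (he : e.Injective)
    (h : Transforms (fun a k => P a (e k)) fun a k => Q a (e k))
    (hPQ : ∀ a, ∀ i ∉ Set.range e, Q a i = P a i) : Transforms P Q := by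
  obtain ⟨R, p, hR⟩ := h
  refine ⟨R.embed e, p, fun a => ((hR a).embed he (hPQ a)).mono (monotone_eval p ?_)⟩
  exact Store.size_le_iff.2 fun k => (P a).length_le_size (e k)

end Transforms

end Transformations

/-! ### Reading a stack with a finite transducer -/

section Transductions

variable {K : Type} {Γ : K → Type} [DecidableEq K] {Λ σ : Type}

/-- Pushes the word `w` on the stack `k`. -/
def pushWord (k : K) (w : List (Γ k)) (q : TM2.Stmt Γ Λ σ) : TM2.Stmt Γ Λ σ :=
  w.foldr (fun x => push k fun _ => x) q

theorem stepAux_pushWord (k : K) (w : List (Γ k)) (q : TM2.Stmt Γ Λ σ) (v : σ) (S : Store Γ) :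
    TM2.stepAux (pushWord k w q) v S =
      TM2.stepAux q v (Function.update S k (w.reverse ++ S k)) := by
  induction w generalizing S with
  | nil => simp [pushWord]
  | cons x w ih => simpa [pushWord] using ih (Function.update S k (x :: S k))

variable [Fintype K]

/-- Pushes the word `w k` on every stack `k`. -/
noncomputable def pushWords (w : Store Γ) (q : TM2.Stmt Γ Λ σ) : TM2.Stmt Γ Λ σ :=
  Finset.univ.toList.foldr (fun k => pushWord k (w k)) q

theorem stepAux_pushWords (w : Store Γ) (q : TM2.Stmt Γ Λ σ) (v : σ) (S : Store Γ) :
    TM2.stepAux (pushWords w q) v S = TM2.stepAux q v fun k => (w k).reverse ++ S k := by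
  suffices ∀ l : List K, l.Nodup → TM2.stepAux (l.foldr (fun k => pushWord k (w k)) q) v S =
      TM2.stepAux q v fun k => if k ∈ l then (w k).reverse ++ S k else S k by
    simpa [pushWords] using this _ Finset.univ.nodup_toList
  intro l
  induction l generalizing S with
  | nil => simp
  | cons i l ih =>
    intro hl
    rw [List.nodup_cons] at hl
    rw [List.foldr_cons, stepAux_pushWord, ih _ hl.2]
    congr 1
    funext k
    rcases eq_or_ne k i with rfl | hk
    · simp [hl.1]
    · simp [hk]

theorem Transforms.write {A : Type*} (P : A → Store Γ) (w : Store Γ) :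
    Transforms P fun a k => (w k).reverse ++ P a k :=
  ⟨{ Λ := Unit, σ := Unit, entry := (), initial := (), stmt := fun _ => pushWords w halt }, 1,
    fun _ => Polynomial.eval_one (R := ℕ) ▸
      .head (congrArg some (stepAux_pushWords _ _ _ _)) (.refl _ _)⟩

/-- A device with finitely many states that reads a word over `α` from left to right and outputs
words over `β`. It stops at the end of the word, or after a symbol for which `next` is `none`. -/
structure Transducer (α β : Type) where
  {State : Type}
  [fintype : Fintype State]
  next : State → α → Option State
  emit : State → α → List β

attribute [instance] Transducer.fintype

namespace Transducer

variable {α β : Type}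

/-- What the transducer outputs on a word. -/
def output (T : Transducer α β) : T.State → List α → List β
  | _, [] => []
  | q, x :: w => T.emit q x ++ (T.next q x).elim [] fun q' => T.output q' w

/-- The part of the word that the transducer does not read. -/
def rest (T : Transducer α β) : T.State → List α → List α
  | _, [] => []
  | q, x :: w => (T.next q x).elim w fun q' => T.rest q' w

/-- The routine that applies the transducer to the stack `i` and pushes the image of its output
under `out k` on every stack `k`. -/
noncomputable def routine {i : K} [Fintype (Γ i)] (T : Transducer (Γ i) β) (q : T.State)
    (out : ∀ k, β → List (Γ k)) : Routine Γ where
  Λ := T.State × Option (Γ i)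
  σ := Option (Γ i)
  entry := (q, none)
  initial := none
  stmt
    | (q, none) => pop i (fun _ x => x) <| branch Option.isSome (goto fun v => (q, v)) halt
    | (q, some x) => pushWords (fun k => (T.emit q x).flatMap (out k)) <|
        load (fun _ => none) <| (T.next q x).elim halt fun q' => goto fun _ => (q', none)

theorem runs_routine {i : K} [Fintype (Γ i)] (T : Transducer (Γ i) β)
    {out : ∀ k, β → List (Γ k)} (hout : ∀ y, out i y = []) (q₀ : T.State) (S : Store Γ) :
    (T.routine q₀ out).Runs (2 * (S i).length + 1) S (Function.update
      (fun k => ((T.output q₀ (S i)).flatMap (out k)).reverse ++ S k) i (T.rest q₀ (S i))) := by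
  suffices ∀ w q S, S i = w → ReachesIn (TM2.step (T.routine q₀ out).stmt) (2 * w.length + 1)
      ⟨some (q, none), none, S⟩ ⟨none, none, Function.update
        (fun k => ((T.output q w).flatMap (out k)).reverse ++ S k) i (T.rest q w)⟩ from
    this _ q₀ S rfl
  intro w
  induction w with
  | nil =>
    intro q S hS
    refine .head (congrArg some ?_) (.refl _ _)
    simp [routine, hS, output, rest]
  | cons x w ih =>
    intro q S hS
    have hpop : TM2.step (T.routine q₀ out).stmt ⟨some (q, none), none, S⟩ =
        some ⟨some (q, some x), some x, Function.update S i w⟩ := by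
      simp [TM2.step, routine, hS]
    let S' : Store Γ := fun k =>
      ((T.emit q x).flatMap (out k)).reverse ++ Function.update S i w k
    have hS' : S' i = w := by simp [S', hout]
    have hpush : TM2.step (T.routine q₀ out).stmt
        ⟨some (q, some x), some x, Function.update S i w⟩ =
        some ⟨(T.next q x).map fun q' => (q', none), none, S'⟩ := by
      cases h : T.next q x <;> simp [TM2.step, routine, stepAux_pushWords, h, S']
    have hcons : ∀ u r, Function.update (fun k => (u.flatMap (out k)).reverse ++ S' k) i r =
        Function.update
          (fun k => ((T.emit q x ++ u).flatMap (out k)).reverse ++ S k) i r := fun u r => by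
      funext k
      rcases eq_or_ne k i with rfl | hk
      · simp
      · simp [S', hk]
    refine .head hpop (.head hpush ?_)
    cases h : T.next q x with
    | none =>
      have hnone : T.output q (x :: w) = T.emit q x ++ [] ∧ T.rest q (x :: w) = S' i := by
        simp [output, rest, h, hS']
      rw [hnone.1, hnone.2, ← hcons,
        show Function.update (fun k => ([].flatMap (out k)).reverse ++ S' k) i (S' i) = S' by simp]
      exact .refl _ _
    | some q' =>
      have hsome : T.output q (x :: w) = T.emit q x ++ T.output q' w ∧
          T.rest q (x :: w) = T.rest q' w := by simp [output, rest, h]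
      rw [hsome.1, hsome.2, ← hcons]
      exact ih q' S' hS'

/-- The transducer that outputs what it reads. -/
abbrev copy (α : Type) : Transducer α α where
  State := Unit
  next _ _ := some ()
  emit _ x := [x]

theorem output_copy (w : List α) : (copy α).output () w = w := by
  induction w with
  | nil => rfl
  | cons x w ih => exact congrArg (x :: ·) ih

theorem rest_eq_nil {T : Transducer α β} (hT : ∀ q x, T.next q x ≠ none) (q : T.State)
    (w : List α) : T.rest q w = [] := by
  induction w generalizing q with
  | nil => rfl
  | cons x w ih =>
    obtain ⟨q', hq'⟩ := Option.ne_none_iff_exists'.1 (hT q x)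
    simp [rest, hq', ih]

end Transducer

theorem Transforms.sweep {A : Type*} (P : A → Store Γ) {i : K} [Finite (Γ i)] {β : Type}
    (T : Transducer (Γ i) β) (q : T.State) {out : ∀ k, β → List (Γ k)} (hout : ∀ y, out i y = []) :
    Transforms P fun a => Function.update
      (fun k => ((T.output q (P a i)).flatMap (out k)).reverse ++ P a k) i (T.rest q (P a i)) :=
  let := Fintype.ofFinite (Γ i)
  ⟨T.routine q out, 2 * X + 1, fun a => (T.runs_routine hout q (P a)).mono <| by
    simpa using (P a).length_le_size i⟩

theorem Transforms.sweep_onto {A : Type*} (P : A → Store fun _ : K => Bool)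
    (T : Transducer Bool Bool) (q : T.State) {i : K} {js : Finset K} (hi : i ∉ js) :
    Transforms P fun a => Function.update
      (fun k => if k ∈ js then (T.output q (P a i)).reverse ++ P a k else P a k)
      i (T.rest q (P a i)) := by
  refine (sweep P (i := i) T q (out := fun k b => if k ∈ js then [b] else [])
    (by simp [hi])).congr_right fun a => ?_
  congr 1
  funext k
  by_cases hk : k ∈ js <;> simp [hk]

end Transductions

/-! ### Subroutine calls -/

section Calls

variable {K L : Type} {Γ : K → Type} {Δ : L → Type}

/-- The contents of two systems of stacks together. -/
def Store.sum (S : Store Γ) (T : Store Δ) : Store (Sum.elim Γ Δ) := fun k => Sum.rec S T k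

/-- The stacks before their first use. -/
def Store.empty : Store Γ := fun _ => []

variable [DecidableEq K] [DecidableEq L]

theorem Store.update_empty_sum (k : K) (w : List (Γ k)) :
    Store.sum (Function.update Store.empty k w) (Store.empty (Γ := Δ)) =
      Function.update Store.empty (.inl k) w :=
  (Sum.rec_update_left (γ := fun k => List (Sum.elim Γ Δ k)) Store.empty Store.empty k w).trans
    (congrArg (fun S : Store (Sum.elim Γ Δ) => Function.update S (.inl k) w)
      (funext fun l => by cases l <;> rfl))

variable [Fintype K] [Fintype L] {A : Type*}

namespace Transforms

theorem frame_left {P Q : A → Store Γ} (h : Transforms P Q) (T : A → Store Δ) :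
    Transforms (fun a => (P a).sum (T a)) fun a => (Q a).sum (T a) :=
  embed (e := Sum.inl) Sum.inl_injective h fun a i hi => by
    cases i with
    | inl k => exact absurd ⟨k, rfl⟩ hi
    | inr l => rfl

theorem frame_right {P Q : A → Store Γ} (h : Transforms P Q) (T : A → Store Δ) :
    Transforms (fun a => (T a).sum (P a)) fun a => (T a).sum (Q a) :=
  embed (e := Sum.inr) Sum.inr_injective h fun a i hi => by
    cases i with
    | inl l => rfl
    | inr k => exact absurd ⟨k, rfl⟩ hi

theorem pour (P : A → Store Γ) {i j : K} (hij : i ≠ j) {α : Type} [Finite α] (η : Γ i ≃ α)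
    (θ : Γ j ≃ α) : Transforms P fun a => Function.update
      (Function.update (P a) j (((P a i).map (η.trans θ.symm)).reverse ++ P a j)) i [] := by
  have : Finite (Γ i) := .of_equiv α η.symm
  refine (sweep P (.copy (Γ i)) ()
    (out := Function.update (fun _ _ => []) j fun x => [θ.symm (η x)])
    fun y => by simp [hij]).congr_right fun a => ?_
  rw [Transducer.output_copy, Transducer.rest_eq_nil fun _ _ => Option.some_ne_none _]
  congr 1
  funext k
  rcases eq_or_ne k j with rfl | hk
  · simp [← List.map_eq_flatMap]
  · simp [hk]

theorem move {P Q : A → Store Γ} {i j e : K} (hij : i ≠ j) (hie : i ≠ e) (hje : j ≠ e) {α : Type}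
    [Finite α] (η : Γ i ≃ α) (θ : Γ j ≃ α) (ζ : Γ e ≃ α) (he : ∀ a, P a e = [])
    (hi : ∀ a, Q a i = []) (hj : ∀ a, Q a j = (P a i).map (η.trans θ.symm) ++ P a j)
    (hQ : ∀ a k, k ≠ i → k ≠ j → Q a k = P a k) : Transforms P Q := by
  refine ((pour P hie η ζ).trans (pour _ hje.symm ζ θ)).congr_right fun a => ?_
  funext k
  rcases eq_or_ne k j with rfl | hkj
  · simp [he, hj, hij.symm, hie.symm, hje]
  rcases eq_or_ne k i with rfl | hki
  · simp [hi, hij, hie]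
  rcases eq_or_ne k e with rfl | hke
  · simp [he, hQ, hki, hkj]
  · simp [hQ, hke, hkj, hki]

end Transforms

theorem initList_eq (M : FinTM2) (w : List (M.Γ M.k₀)) :
    Turing.initList M w =
      ⟨some M.main, M.initialState, Function.update Store.empty M.k₀ w⟩ := by
  unfold Turing.initList
  congr 1
  funext k
  rcases eq_or_ne k M.k₀ with rfl | hk
  · simp
  · simp [hk, Store.empty]

theorem haltList_eq (M : FinTM2) (w : List (M.Γ M.k₁)) :
    Turing.haltList M w = ⟨none, M.initialState, Function.update Store.empty M.k₁ w⟩ := by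
  unfold Turing.haltList
  congr 1
  funext k
  rcases eq_or_ne k M.k₁ with rfl | hk
  · simp
  · simp [hk, Store.empty]

theorem PolyTimeComputable.of_transforms {μ : Str → Str} {k : K} (η : Γ k ≃ Bool)
    (h : Transforms (fun x : Str => Function.update Store.empty k (x.1.map η.symm))
      fun x => Function.update Store.empty k ((μ x).1.map η.symm)) : PolyTimeComputable μ := by
  obtain ⟨R, p, hR⟩ := h
  let : Fintype (Γ k) := .ofEquiv Bool η.symm
  let M : FinTM2 :=
    { k₀ := k, k₁ := k, main := R.entry, initialState := R.initial, m := R.stmt, .. }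
  have hrun : ∀ x : Str, Nonempty (Turing.TM2OutputsInTime M (x.1.map η.symm)
      (some ((μ x).1.map η.symm)) (p.eval x.1.length)) := fun x => by
    unfold Turing.TM2OutputsInTime
    rw [Option.map_some, initList_eq, haltList_eq]
    refine ((hR x).mono (monotone_eval p ?_)).nonempty_evalsToInTime
    refine Store.size_update_le (Store.size_le_iff.2 fun _ => Nat.zero_le _) (by simp)
  exact ⟨⟨⟨M, η, η⟩, p, fun x => (hrun x).some⟩⟩

theorem PolyTimeComputable.exists_transforms {μ : Str → Str} (hμ : PolyTimeComputable μ) :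
    ∃ (L : Type) (Δ : L → Type) (_ : DecidableEq L) (_ : Fintype L) (k₀ k₁ : L)
      (η₀ : Δ k₀ ≃ Bool) (η₁ : Δ k₁ ≃ Bool),
      Transforms (fun x : Str => Function.update Store.empty k₀ (x.1.map η₀.symm))
        fun x => Function.update Store.empty k₁ ((μ x).1.map η₁.symm) := by
  obtain ⟨⟨⟨M, η₀, η₁⟩, p, hM⟩⟩ := hμ
  let := M.kFin
  have := M.ΛFin
  have := M.σFin
  refine ⟨M.K, M.Γ, M.kDecidableEq, M.kFin, M.k₀, M.k₁, η₀, η₁,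
    { entry := M.main, initial := M.initialState, stmt := M.m }, p, fun x => ?_⟩
  have hx := hM x
  unfold Turing.TM2OutputsInTime at hx
  rw [Option.map_some, initList_eq, haltList_eq] at hx
  refine (ReachesIn.of_evalsToInTime hx).mono (monotone_eval p ?_)
  simpa using Store.length_le_size (Function.update Store.empty M.k₀ (x.1.map η₀.symm)) M.k₀

theorem Transforms.call {μ : Str → Str} (hμ : PolyTimeComputable μ) {k : K} (η : Γ k ≃ Bool)
    {P Q : A → Store Γ} (x : A → Str) (hP : ∀ a, P a k = (x a).1.map η.symm)
    (hQ : ∀ a, Q a k = (μ (x a)).1.map η.symm) (hPQ : ∀ a i, i ≠ k → Q a i = P a i) :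
    ∃ (L : Type) (Δ : L → Type) (_ : DecidableEq L) (_ : Fintype L), Transforms
      (fun a => (P a).sum (Store.empty (Γ := Δ))) fun a => (Q a).sum (Store.empty (Γ := Δ)) := by
  obtain ⟨L, Δ, _, _, k₀, k₁, η₀, η₁, hM⟩ := hμ.exists_transforms
  have recode {α β : Type} (η : α ≃ Bool) (θ : β ≃ Bool) (w : List Bool) :
      w.map θ.symm = (w.map η.symm).map (η.trans θ.symm) ++ [] := by simp [Function.comp_def]
  let Θ : Unit → Type := fun _ => Bool
  refine ⟨L ⊕ Unit, Sum.elim Δ Θ, inferInstance, inferInstance, ?_⟩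
  let S (T : Store Δ) (a : A) : Store (Sum.elim Γ (Sum.elim Δ Θ)) :=
    Store.sum (Function.update (P a) k []) (T.sum Store.empty)
  have load : Transforms (fun a => (P a).sum Store.empty)
      fun a => S (Function.update Store.empty k₀ ((x a).1.map η₀.symm)) a := by
    refine move (i := .inl k) (j := .inr (.inl k₀)) (e := .inr (.inr ())) (by simp) (by simp)
      (by simp) η η₀ (.refl Bool) (fun _ => rfl) (fun a => ?_) (fun a => ?_) fun a i hk hk₀ => ?_
    · simp [S, Store.sum]
    · simp only [S, Store.sum, Store.empty, Function.update_self, hP]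
      exact recode η η₀ (x a).1
    · obtain i | l | ⟨⟩ := i <;> simp_all [S, Store.sum, Store.empty]
  have run : Transforms (fun a => S (Function.update Store.empty k₀ ((x a).1.map η₀.symm)) a)
      fun a => S (Function.update Store.empty k₁ ((μ (x a)).1.map η₁.symm)) a :=
    ((hM.comap x).frame_left fun _ => Store.empty).frame_right fun a => Function.update (P a) k []
  have unload : Transforms
      (fun a => S (Function.update Store.empty k₁ ((μ (x a)).1.map η₁.symm)) a)
      fun a => (Q a).sum Store.empty := by
    refine move (i := .inr (.inl k₁)) (j := .inl k) (e := .inr (.inr ())) (by simp) (by simp)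
      (by simp) η₁ η (.refl Bool) (fun _ => rfl) (fun _ => ?_) (fun a => ?_) fun a i hk₁ hk => ?_
    · simp [Store.sum, Store.empty]
    · simp only [S, Store.sum, Function.update_self, hQ]
      exact recode η₁ η (μ (x a)).1
    · obtain i | l | ⟨⟩ := i <;> simp_all [S, Store.sum, Store.empty]
  exact load.trans (run.trans unload)

theorem Transforms.duplicate {i j k : K} (hij : i ≠ j) (hik : i ≠ k) (hjk : j ≠ k) : Transforms
    (fun w : List Bool => (Function.update Store.empty i w : Store fun _ : K => Bool))
    fun w => Function.update (Function.update Store.empty i w) j w := by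
  have reverse : Transforms
      (fun w : List Bool => (Function.update Store.empty i w : Store fun _ : K => Bool))
      fun w => Function.update Store.empty k w.reverse := by
    refine (pour _ hik (.refl Bool) (.refl Bool)).congr_right fun w => ?_
    funext l
    by_cases hi : l = i <;> by_cases hk : l = k <;> simp_all [Store.empty]
  refine (reverse.trans (.sweep_onto _ (.copy Bool) () (i := k) (js := {i, j})
    (by simp [hik.symm, hjk.symm]))).congr_right fun w => ?_
  rw [Transducer.output_copy, Transducer.rest_eq_nil fun _ _ => Option.some_ne_none _]
  funext l
  by_cases hi : l = i <;> by_cases hj : l = j <;> by_cases hk : l = k <;>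
    simp_all [Store.empty]

theorem PolyTimeComputable.map₂ {f : Str → Str → Str} {μ₁ μ₂ : Str → Str}
    (hμ₁ : PolyTimeComputable μ₁) (hμ₂ : PolyTimeComputable μ₂) {i j k : K} (hij : i ≠ j)
    (hik : i ≠ k) (hjk : j ≠ k) (hf : Transforms
      (fun p : Str × Str => (Function.update (Function.update Store.empty i p.1.1) j p.2.1 :
        Store fun _ : K => Bool))
      fun p => Function.update Store.empty i (f p.1 p.2).1) :
    PolyTimeComputable fun x => f (μ₁ x) (μ₂ x) := by
  let S (u v : List Bool) : Store fun _ : K => Bool :=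
    Function.update (Function.update Store.empty i u) j v
  obtain ⟨L₁, Δ₁, _, _, call₁⟩ := Transforms.call hμ₁ (k := i) (.refl Bool)
    (P := fun x : Str => S x.1 x.1) (Q := fun x => S (μ₁ x).1 x.1) id
    (fun x => by simp [S, hij, Equiv.refl]) (fun x => by simp [S, hij, Equiv.refl])
    fun x l hl => by by_cases hj : l = j <;> simp [S, hl, hj]
  obtain ⟨L₂, Δ₂, _, _, call₂⟩ := Transforms.call hμ₂ (k := Sum.inl j) (.refl Bool)
    (P := fun x : Str => (S (μ₁ x).1 x.1).sum (Store.empty (Γ := Δ₁)))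
    (Q := fun x => (S (μ₁ x).1 (μ₂ x).1).sum Store.empty) id
    (fun x => (Function.update_self ..).trans (List.map_id _).symm)
    (fun x => (Function.update_self ..).trans (List.map_id _).symm)
    fun x l hl => by obtain l | l := l <;> simp_all [S, Store.sum]
  have merge := ((hf.comap fun x => (μ₁ x, μ₂ x)).frame_left
    fun _ => Store.empty (Γ := Δ₁)).frame_left fun _ => Store.empty (Γ := Δ₂)
  have copy := ((Transforms.duplicate hij hik hjk).comap fun x : Str => x.1).frame_left
    fun _ => Store.empty (Γ := Δ₁)
  have total := ((copy.trans call₁).frame_left fun _ => Store.empty).trans (call₂.trans merge)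
  let η : Sum.elim (Sum.elim (fun _ : K => Bool) Δ₁) Δ₂ (.inl (.inl i)) ≃ Bool := .refl Bool
  let single (w : List Bool) : Store fun _ : K => Bool := Function.update Store.empty i w
  have sum_single (w : List Bool) : ((single w).sum (Store.empty (Γ := Δ₁))).sum
      (Store.empty (Γ := Δ₂)) = Function.update Store.empty (.inl (.inl i)) (w.map η.symm) := by
    rw [show w.map η.symm = w from List.map_id w]
    have inner := Store.update_empty_sum (Γ := fun _ => Bool) (Δ := Δ₁) i w
    exact (congrArg (Store.sum · Store.empty) inner).trans
      (Store.update_empty_sum (Γ := Sum.elim (fun _ => Bool) Δ₁) (.inl i) w)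
  refine .of_transforms η ?_
  exact (funext fun x : Str => sum_single x.1) ▸ total.congr_right fun x => sum_single _

end Calls

end StackMachines

/-! ### The reductions as functions on strings -/

/-- The length of the block of ones at the beginning of a string. -/
def ones : List Bool → ℕ
  | true :: u => ones u + 1
  | _ => 0

/-- What remains of a string after a number in unary has been read. -/
def skip : List Bool → List Bool
  | true :: u => skip u
  | _ :: u => u
  | [] => []

theorem ones_unary (k : ℕ) (u : List Bool) : ones (unary k ++ u) = k := by
  induction k with
  | zero => rfl
  | succ k ih => simpa [unary, List.replicate_succ, ones] using ih

theorem skip_unary (k : ℕ) (u : List Bool) : skip (unary k ++ u) = u := by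
  induction k with
  | zero => rfl
  | succ k ih => simpa [unary, List.replicate_succ, skip] using ih

/-- The entrywise sum of the lists of `k` unary numbers at the beginning of two strings. -/
def addHeaders : ℕ → List Bool → List Bool → List Bool
  | 0, _, _ => []
  | k + 1, u, w => unary (ones u + ones w) ++ addHeaders k (skip u) (skip w)

theorem header_succ {n : ℕ} (m : Fin (n + 1) → ℕ) :
    header m = unary (m 0) ++ header fun i : Fin n => m i.succ := by
  simp [header, List.ofFn_succ]

theorem addHeaders_header {n : ℕ} (m m' : Fin n → ℕ) (u w : List Bool) :
    addHeaders n (header m ++ u) (header m' ++ w) = header fun i => m i + m' i := by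
  induction n with
  | zero => simp [addHeaders, header]
  | succ n ih =>
    simp only [header_succ, addHeaders, List.append_assoc, ones_unary, skip_unary, ih]

theorem addHeaders_header_nil {n : ℕ} (m : Fin n → ℕ) (u : List Bool) :
    addHeaders n (header m ++ u) [] = header m := by
  induction n with
  | zero => simp [addHeaders, header]
  | succ n ih =>
    simp only [header_succ, addHeaders, List.append_assoc, ones_unary, skip_unary, ones, skip,
      add_zero, ih]

theorem skip_iterate_header {n : ℕ} (m : Fin n → ℕ) (u : List Bool) :
    skip^[n] (header m ++ u) = u := by
  induction n with
  | zero => simp [header]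
  | succ n ih =>
    rw [Function.iterate_succ_apply, header_succ, List.append_assoc, skip_unary, ih]

/-- The code of the variable number `p` of the first block. -/
def bitCode (p : ℕ) : List Bool := false :: false :: false :: unary p

/-- What `BoolExpr.pins` puts in front of the code of an expression. -/
def pinsCode (a c : ℕ) : List Bool :=
  (List.range c).flatMap fun i => [true, false, false, true] ++ bitCode (a + i + 1)

theorem BoolExpr.code_pins {n : ℕ} {m : Fin (n + 1) → ℕ}
    (e : BoolExpr ((i : Fin (n + 1)) × Fin (m i))) (a c : ℕ) (h : a + c < m 0) :
    (e.pins a c h).code = pinsCode a c ++ e.code := by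
  induction c generalizing a with
  | zero => rfl
  | succ c ih =>
    simp [pins, pinsCode, code, ih, bitCode, unary, List.range_succ_eq_map, List.flatMap_map,
      add_right_comm _ 1, add_assoc]

/-- What a reader of the code of an expression expects next. -/
inductive Mode : Type
  | tag | secondOfVar | secondOfNot | block | blockRest | position
  deriving DecidableEq

instance : Fintype Mode where
  elems := {.tag, .secondOfVar, .secondOfNot, .block, .blockRest, .position}
  complete q := by cases q <;> decide

/-- The transducer that renames the variables in the code of an expression by `shiftVar`. -/
abbrev shifter : Transducer Bool Bool where
  State := Mode
  next
    | .tag, false => some .secondOfVar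
    | .tag, true => some .secondOfNot
    | .secondOfVar, false => some .block
    | .secondOfVar, true => some .tag
    | .secondOfNot, _ => some .tag
    | .block, false => some .position
    | .block, true => some .blockRest
    | .blockRest, false => some .position
    | .blockRest, true => some .blockRest
    | .position, false => some .tag
    | .position, true => some .position
  emit
    | .block, false => [false, true]
    | _, b => [b]

theorem output_shifter_position (j : ℕ) (u : List Bool) :
    shifter.output .position (unary j ++ u) = unary j ++ shifter.output .tag u := by
  induction j with
  | zero => rfl
  | succ j ih => exact congrArg (true :: ·) ih

theorem output_shifter_blockRest (i : ℕ) (u : List Bool) :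
    shifter.output .blockRest (unary i ++ u) = unary i ++ shifter.output .position u := by
  induction i with
  | zero => rfl
  | succ i ih => exact congrArg (true :: ·) ih

theorem output_shifter_block {n : ℕ} (i : Fin (n + 1)) (j : ℕ) (u : List Bool) :
    shifter.output .block (unary i ++ unary j ++ u) =
      unary i ++ unary (j + offset i) ++ shifter.output .tag u := by
  rw [List.append_assoc, List.append_assoc]
  cases i using Fin.cases with
  | zero => exact congrArg (false :: true :: ·) (output_shifter_position j u)
  | succ i =>
    rw [← output_shifter_position]
    exact congrArg (true :: ·) (output_shifter_blockRest i (unary j ++ u))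

theorem output_shifter_code {n : ℕ} {m M : Fin (n + 1) → ℕ} (h : ∀ i, m i + offset i ≤ M i)
    (e : BoolExpr ((i : Fin (n + 1)) × Fin (m i))) (u : List Bool) :
    shifter.output .tag (e.code ++ u) =
      (e.rename (shiftVar h)).code ++ shifter.output .tag u := by
  induction e generalizing u with
  | var v =>
    exact congrArg (false :: false :: ·) (output_shifter_block v.1 v.2 u)
  | not e ih => exact congrArg (false :: true :: ·) (ih u)
  | and e₁ e₂ ih₁ ih₂ | or e₁ e₂ ih₁ ih₂ =>
    simp [BoolExpr.code, BoolExpr.rename, Transducer.output, ih₁, ih₂]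

/-- The code of one of the two disjuncts of `Input.combine`: the expression with the code `e`,
after some connectives, the first variable and the conditions of `BoolExpr.pins`. -/
def branchCode (pre mid : List Bool) (a c : ℕ) (e : List Bool) : List Bool :=
  pre ++ bitCode 0 ++ pinsCode a c ++ mid ++ shifter.output .tag e

/-- `Input.combine` as a function on strings. -/
def combineStr (n : ℕ) (u w : Str) : Str :=
  ⟨true :: (addHeaders (n + 1) u.1 w.1 ++
    branchCode [true, true, true, false] [] (ones u.1) (ones w.1) (skip^[n + 1] u.1) ++
    branchCode [true, false, false, true] [false, true] (ones w.1) (ones u.1)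
      (skip^[n + 1] w.1)), List.cons_ne_nil _ _⟩

/-- Inserts a word between the numbers of variables and the expression. -/
def insertStr (n : ℕ) (word : List Bool) (u : Str) : Str :=
  ⟨addHeaders (n + 1) u.1 [] ++ word ++ skip^[n + 1] u.1, by simp [addHeaders, unary]⟩

namespace Input

variable {n : ℕ}

theorem header_size (F G : Input n) :
    header (size F G) = true :: header fun i => F.m i + G.m i := by
  simp [header_succ, size, offset, unary, List.replicate_succ]

theorem ones_code (F : Input n) : ones F.code.1 = F.m 0 := by
  simp only [code, header_succ, List.append_assoc, ones_unary]

theorem combineStr_code (F G : Input n) : combineStr n F.code G.code = (combine F G).code := by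
  have code_left := output_shifter_code (left_le_size F G) F.expr []
  have code_right := output_shifter_code (right_le_size F G) G.expr []
  simp only [List.append_nil, Transducer.output] at code_left code_right
  refine Subtype.ext ?_
  simp only [combineStr, ones_code]
  simp [code, header_size, addHeaders_header, skip_iterate_header, branchCode, code_left,
    code_right, BoolExpr.code, BoolExpr.code_pins, left, right, bitCode, unary]

theorem insertStr_code (F : Input n) (word : List Bool) :
    (insertStr n word F.code).1 = header F.m ++ word ++ F.expr.code := by
  simp only [insertStr, code, addHeaders_header_nil, skip_iterate_header]

theorem insertStr_code_selectOne (F : Input n) :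
    insertStr n ([true, false] ++ bitCode 0) F.code = (selectOne F).code :=
  Subtype.ext <| (F.insertStr_code _).trans <| by simp [code, BoolExpr.code, bitCode, unary]

theorem insertStr_code_selectZero (F : Input n) :
    insertStr n ([true, true] ++ bitCode 0 ++ [false, true]) F.code = (selectZero F).code :=
  Subtype.ext <| (F.insertStr_code _).trans <| by simp [code, BoolExpr.code, bitCode, unary]

end Input

/-! ### Programs for the reductions -/

/-- The stacks of the programs: two arguments, the first number `lo b` and the length `cnt b` of the
lists of variables that `pinsCode` needs, the output and an auxiliary stack. -/
inductive Tape : Type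
  | arg (b : Bool) | lo (b : Bool) | cnt (b : Bool) | out | tmp
  deriving DecidableEq

instance : Fintype Tape where
  elems := {.arg false, .arg true, .lo false, .lo true, .cnt false, .cnt true, .out, .tmp}
  complete t := by rcases t with (_ | _) | (_ | _) | (_ | _) | _ | _ <;> decide

/-- What the stacks stand for between two steps of a program. -/
@[ext]
structure Registers where
  arg : Bool → List Bool
  lo : Bool → ℕ
  cnt : Bool → ℕ
  out : List Bool

namespace Registers

/-- The contents of the stacks: numbers in unary, the output in reverse order. -/
def store (c : Registers) : Store fun _ : Tape => Bool
  | .arg b => c.arg b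
  | .lo b => List.replicate (c.lo b) true
  | .cnt b => List.replicate (c.cnt b) true
  | .out => c.out.reverse
  | .tmp => []

/-- The function on registers is computed by a routine in polynomial time. -/
def Feasible (f : Registers → Registers) : Prop := Transforms store fun c => (f c).store

variable {f g : Registers → Registers}

theorem Feasible.comp (hg : Feasible g) (hf : Feasible f) : Feasible (g ∘ f) :=
  Transforms.trans hf (Transforms.comap hg f)

/-- Appends a word to the output. -/
def print (w : List Bool) (c : Registers) : Registers := { c with out := c.out ++ w }

theorem feasible_print (w : List Bool) : Feasible (print w) := by
  refine (Transforms.write store (Function.update Store.empty .out w)).congr_right fun c => ?_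
  funext k
  cases k <;> simp [store, print, Store.empty]

/-- Increases the number `lo b`. -/
def incr (b : Bool) (c : Registers) : Registers :=
  { c with lo := Function.update c.lo b (c.lo b + 1) }

theorem feasible_incr (b : Bool) : Feasible (incr b) := by
  refine (Transforms.write store (Function.update Store.empty (.lo b) [true])).congr_right
    fun c => ?_
  funext k
  rcases k with _ | b' | _ | _ | _
  case lo => by_cases hb : b' = b <;> simp [store, incr, Store.empty, hb, List.replicate_succ]
  all_goals simp [store, incr, Store.empty]

/-- Appends the number `lo b` to the output, as a block of ones. -/
def printLo (b : Bool) (c : Registers) : Registers :=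
  { c with out := c.out ++ List.replicate (c.lo b) true }

theorem feasible_printLo (b : Bool) : Feasible (printLo b) := by
  have pour := Transforms.pour store (i := .lo b) (j := .tmp) (by simp) (.refl Bool) (.refl Bool)
  refine (pour.trans (.sweep_onto _ (.copy Bool) () (i := .tmp) (js := {.lo b, .out})
    (by simp))).congr_right fun c => ?_
  rw [Transducer.output_copy, Transducer.rest_eq_nil fun _ _ => Option.some_ne_none _]
  funext k
  rcases k with _ | b' | _ | _ | _
  case lo => by_cases hb : b' = b <;> simp [store, printLo, hb]
  all_goals simp [store, printLo]

/-- Removes the argument `b` and appends to the output what the transducer makes of it. -/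
def transduce (T : Transducer Bool Bool) (q : T.State) (b : Bool) (c : Registers) : Registers :=
  { c with arg := Function.update c.arg b [], out := c.out ++ T.output q (c.arg b) }

theorem feasible_transduce {T : Transducer Bool Bool} (hT : ∀ q x, T.next q x ≠ none)
    (q : T.State) (b : Bool) : Feasible (transduce T q b) := by
  refine (Transforms.sweep_onto store T q (i := .arg b) (js := {.out}) (by simp)).congr_right
    fun c => ?_
  rw [Transducer.rest_eq_nil hT]
  funext k
  rcases k with b' | _ | _ | _ | _
  case arg => by_cases hb : b' = b <;> simp [store, transduce, hb]
  all_goals simp [store, transduce]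

/-- Removes the argument `b`. -/
def clearArg (b : Bool) (c : Registers) : Registers :=
  { c with arg := Function.update c.arg b [] }

theorem feasible_clearArg (b : Bool) : Feasible (clearArg b) := by
  refine (Transforms.sweep_onto store (.copy Bool) () (i := .arg b) (js := ∅) (by simp)).congr_right
    fun c => ?_
  rw [Transducer.rest_eq_nil fun _ _ => Option.some_ne_none _]
  funext k
  rcases k with b' | _ | _ | _ | _
  case arg => by_cases hb : b' = b <;> simp [store, clearArg, hb]
  all_goals simp [store, clearArg]

/-- Sets the number `lo b` to zero. -/
def clearLo (b : Bool) (c : Registers) : Registers := { c with lo := Function.update c.lo b 0 }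

theorem feasible_clearLo (b : Bool) : Feasible (clearLo b) := by
  refine (Transforms.sweep_onto store (.copy Bool) () (i := .lo b) (js := ∅) (by simp)).congr_right
    fun c => ?_
  rw [Transducer.rest_eq_nil fun _ _ => Option.some_ne_none _]
  funext k
  rcases k with _ | b' | _ | _ | _
  case lo => by_cases hb : b' = b <;> simp [store, clearLo, hb]
  all_goals simp [store, clearLo]

/-- The transducer that reads a number in unary and outputs its block of ones. -/
abbrev unaryReader : Transducer Bool Bool where
  State := Unit
  next _ b := if b then some () else none
  emit _ b := if b then [true] else []

theorem output_unaryReader (w : List Bool) :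
    unaryReader.output () w = List.replicate (ones w) true := by
  induction w with
  | nil => rfl
  | cons b w ih => cases b <;> simp [Transducer.output, ones, ih, List.replicate_succ]

theorem rest_unaryReader (w : List Bool) : unaryReader.rest () w = skip w := by
  induction w with
  | nil => rfl
  | cons b w ih => cases b <;> simp [Transducer.rest, skip, ih]

/-- Reads a number in unary from the argument `b` and appends it to the output, as a block of
ones. -/
def copyOnes (b : Bool) (c : Registers) : Registers :=
  { c with
    arg := Function.update c.arg b (skip (c.arg b))
    out := c.out ++ List.replicate (ones (c.arg b)) true }

theorem feasible_copyOnes (b : Bool) : Feasible (copyOnes b) := by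
  refine (Transforms.sweep_onto store unaryReader () (i := .arg b) (js := {.out})
    (by simp)).congr_right fun c => ?_
  rw [output_unaryReader, rest_unaryReader]
  funext k
  rcases k with b' | _ | _ | _ | _
  case arg => by_cases hb : b' = b <;> simp [store, copyOnes, hb]
  all_goals simp [store, copyOnes]

/-- Like `copyOnes`, and adds the number to `lo b` and to `cnt (!b)`. -/
def recordOnes (b : Bool) (c : Registers) : Registers :=
  { copyOnes b c with
    lo := Function.update c.lo b (ones (c.arg b) + c.lo b)
    cnt := Function.update c.cnt (!b) (ones (c.arg b) + c.cnt (!b)) }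

theorem feasible_recordOnes (b : Bool) : Feasible (recordOnes b) := by
  refine (Transforms.sweep_onto store unaryReader () (i := .arg b)
    (js := {.lo b, .cnt (!b), .out}) (by simp)).congr_right fun c => ?_
  rw [output_unaryReader, rest_unaryReader]
  funext k
  rcases k with b' | b' | b' | _ | _
  case arg | lo => by_cases hb : b' = b <;> simp [store, recordOnes, copyOnes, hb]
  case cnt => by_cases hb : b' = !b <;> simp [store, recordOnes, copyOnes, hb]
  all_goals simp [store, recordOnes, copyOnes]

/-- Reads the numbers of variables from both arguments and outputs their sums. -/
def printHeaders (k : ℕ) (c : Registers) : Registers :=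
  { c with
    arg := fun b => skip^[k] (c.arg b)
    out := c.out ++ addHeaders k (c.arg false) (c.arg true) }

theorem feasible_printHeaders (k : ℕ) : Feasible (printHeaders k) := by
  induction k with
  | zero => exact (feasible_print []).congr_right fun c => by simp [print, printHeaders, addHeaders]
  | succ k ih =>
    have next := (feasible_print [false]).comp ((feasible_copyOnes true).comp
      (feasible_copyOnes false))
    refine (ih.comp next).congr_right fun c => congrArg store ?_
    refine Registers.ext (funext fun b => ?_) rfl rfl ?_
    · cases b <;> simp [printHeaders, print, copyOnes]
    · simp [printHeaders, print, copyOnes, addHeaders, unary]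

/-- Appends to the output the conditions on the next `k` variables after `lo b`. -/
def printPins (b : Bool) (k : ℕ) (c : Registers) : Registers :=
  { c with
    lo := Function.update c.lo b (c.lo b + k)
    out := c.out ++ pinsCode (c.lo b) k }

theorem feasible_printPins_one (b : Bool) : Feasible (printPins b 1) := by
  have next := (feasible_print [false]).comp ((feasible_printLo b).comp
    ((feasible_print [true, false, false, true, false, false, false]).comp (feasible_incr b)))
  refine next.congr_right fun c => congrArg store ?_
  simp [print, printLo, incr, printPins, pinsCode, bitCode, unary]

theorem pinsCode_succ (a k : ℕ) : pinsCode a (k + 1) = pinsCode a k ++ pinsCode (a + k) 1 := by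
  simp [pinsCode, List.range_succ]

theorem length_pinsCode_le (a k : ℕ) : (pinsCode a k).length ≤ k * (a + k + 8) := by
  induction k with
  | zero => simp [pinsCode]
  | succ k ih =>
    have length_one : (pinsCode (a + k) 1).length = a + k + 9 := by simp [pinsCode, bitCode, unary]
    rw [pinsCode_succ, List.length_append, length_one]
    nlinarith

theorem printPins_succ (b : Bool) (k : ℕ) (c : Registers) :
    printPins b (k + 1) c = printPins b 1 (printPins b k c) := by
  simp [printPins, pinsCode_succ _ k, add_assoc]

theorem size_store_printPins_le (b : Bool) {k : ℕ} (c : Registers) (hk : k ≤ c.store.size) :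
    (printPins b k c).store.size ≤ c.store.size + c.store.size * (2 * c.store.size + 8) := by
  have store_printPins : (printPins b k c).store =
      Function.update (Function.update c.store (.lo b) (List.replicate (c.lo b + k) true)) .out
        ((pinsCode (c.lo b) k).reverse ++ c.store .out) := by
    funext i
    rcases i with _ | b' | _ | _ | _
    case lo => by_cases hb : b' = b <;> simp [store, printPins, hb]
    all_goals simp [store, printPins]
  have hlo : c.lo b ≤ c.store.size := by simpa [store] using c.store.length_le_size (.lo b)
  have hpins : (pinsCode (c.lo b) k).length ≤ c.store.size * (2 * c.store.size + 8) :=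
    (length_pinsCode_le _ _).trans (Nat.mul_le_mul hk (by omega))
  rw [store_printPins]
  refine Store.size_update_le (Store.size_update_le (Nat.le_add_right _ _) ?_) ?_
  · rw [List.length_replicate]
    nlinarith
  · rw [List.length_append, List.length_reverse]
    have := c.store.length_le_size .out
    omega

/-- Sets the number `cnt b` to `j`. -/
def setCnt (b : Bool) (j : ℕ) (c : Registers) : Registers :=
  { c with cnt := Function.update c.cnt b j }

theorem store_setCnt (b : Bool) (j : ℕ) (c : Registers) :
    (setCnt b j c).store = Function.update c.store (.cnt b) (List.replicate j true) := by
  funext k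
  rcases k with _ | _ | b' | _ | _
  case cnt => by_cases hb : b' = b <;> simp [store, setCnt, hb]
  all_goals simp [store, setCnt]

/-- Appends to the output the conditions on all of the `cnt b` variables after `lo b`. -/
def printAllPins (b : Bool) (c : Registers) : Registers :=
  setCnt b 0 (printPins b (c.cnt b) c)

theorem feasible_printAllPins (b : Bool) : Feasible (printAllPins b) := by
  let I (c : Registers) (j : ℕ) : Registers := setCnt b j (printPins b (c.cnt b - j) c)
  have hI (c : Registers) : I c (c.cnt b) = c := by simp [I, setCnt, printPins, pinsCode]
  have body : Transforms (fun x : {x : Registers × ℕ // x.2 < x.1.cnt b} =>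
      Function.update (I x.1.1 (x.1.2 + 1)).store (.cnt b)
        ((I x.1.1 (x.1.2 + 1)).store (.cnt b)).tail) fun x => (I x.1.1 x.1.2).store := by
    refine ((feasible_printPins_one b).comap fun x : {x : Registers × ℕ // x.2 < x.1.cnt b} =>
      setCnt b x.1.2 (I x.1.1 (x.1.2 + 1))).congr_left ?_ |>.congr_right ?_
    · rintro ⟨⟨c, j⟩, hj⟩
      simp [I, store_setCnt]
    · rintro ⟨⟨c, j⟩, hj⟩
      have hsub : c.cnt b - j = c.cnt b - (j + 1) + 1 :=
        (Nat.succ_pred_eq_of_pos (Nat.sub_pos_of_lt hj)).symm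
      refine congrArg store ?_
      simp only [I, hsub, printPins_succ b (c.cnt b - (j + 1))]
      simp [setCnt, printPins]
  have size (c : Registers) (j : ℕ) (hj : j ≤ c.cnt b) : (I c j).store.size ≤
      (X + X * (2 * X + 8) : Polynomial ℕ).eval (I c (c.cnt b)).store.size := by
    have hcnt : c.cnt b ≤ c.store.size := by simpa [store] using c.store.length_le_size (.cnt b)
    have hpins := size_store_printPins_le b c ((Nat.sub_le _ j).trans hcnt)
    have hlength : (List.replicate j true).length ≤
        c.store.size + c.store.size * (2 * c.store.size + 8) := by
      rw [List.length_replicate]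
      exact hj.trans (hcnt.trans (Nat.le_add_right _ _))
    rw [hI]
    simp only [I, store_setCnt]
    simpa using Store.size_update_le hpins hlength
  refine ((Transforms.loop (I := fun c j => (I c j).store) (N := fun c => c.cnt b) (k := .cnt b)
    (fun c j => by simp [I, store_setCnt]) body _ size).congr_left fun c => ?_).congr_right
    fun c => ?_
  · simp only [hI]
  · simp only [I, Nat.sub_zero, printAllPins]

/-- Outputs one of the disjuncts of `Input.combine`. -/
def printBranch (pre mid : List Bool) (b : Bool) (c : Registers) : Registers where
  arg := Function.update c.arg b []
  lo := Function.update c.lo b 0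
  cnt := Function.update c.cnt b 0
  out := c.out ++ branchCode pre mid (c.lo b) (c.cnt b) (c.arg b)

theorem feasible_printBranch (pre mid : List Bool) (b : Bool) :
    Feasible (printBranch pre mid b) := by
  have shift := feasible_transduce (T := shifter) (by rintro (_ | _) (_ | _) <;> simp) .tag b
  refine ((feasible_clearLo b).comp (shift.comp ((feasible_print mid).comp
    ((feasible_printAllPins b).comp (feasible_print (pre ++ bitCode 0)))))).congr_right
    fun c => congrArg store ?_
  simp [printBranch, branchCode, transduce, clearLo, print, printAllPins, setCnt, printPins]

/-- The registers that hold two strings as arguments. -/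
def ofArgs (u w : List Bool) : Registers := ⟨fun b => if b then w else u, 0, 0, []⟩

/-- The registers that hold an output and nothing else. -/
def ofOutput (v : List Bool) : Registers := ⟨fun _ => [], 0, 0, v⟩

theorem Feasible.polyTimeComputable (hf : Feasible f) {F : Str → Str → Str}
    (hfF : ∀ u w : Str, f (ofArgs u.1 w.1) = ofOutput (F u w).1) {μ₁ μ₂ : Str → Str}
    (hμ₁ : PolyTimeComputable μ₁) (hμ₂ : PolyTimeComputable μ₂) :
    PolyTimeComputable fun x => F (μ₁ x) (μ₂ x) := by
  refine .map₂ (K := Tape) hμ₁ hμ₂ (i := .arg false) (j := .arg true) (k := .tmp) (by simp)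
    (by simp) (by simp) ?_
  have run := hf.comap fun p : Str × Str => ofArgs p.1.1 p.2.1
  refine ((run.trans (.pour _ (i := .out) (j := .arg false) (by simp) (.refl Bool)
    (.refl Bool))).congr_left fun p => ?_).congr_right fun p => ?_
  · funext k
    rcases k with (_ | _) | _ | _ | _ | _ <;> simp [store, ofArgs, Store.empty]
  · funext k
    rcases k with (_ | _) | _ | _ | _ | _ <;> simp [store, hfF, ofOutput, Store.empty]

end Registers

open Registers

variable {μ μ₁ μ₂ : Str → Str}

theorem PolyTimeComputable.combineStr (n : ℕ) (hμ₁ : PolyTimeComputable μ₁)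
    (hμ₂ : PolyTimeComputable μ₂) :
    PolyTimeComputable fun x => combineStr n (μ₁ x) (μ₂ x) := by
  have records := (feasible_print [false]).comp ((feasible_recordOnes true).comp
    ((feasible_recordOnes false).comp (feasible_print [true])))
  have branches := (feasible_printBranch [true, false, false, true] [false, true] true).comp
    (feasible_printBranch [true, true, true, false] [] false)
  refine (branches.comp ((feasible_printHeaders n).comp records)).polyTimeComputable
    (fun u w => ?_) hμ₁ hμ₂
  refine Registers.ext (funext fun b => ?_) (funext fun b => ?_) (funext fun b => ?_) ?_
  · cases b <;> simp [printBranch, ofOutput]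
  · cases b <;> simp [printBranch, ofOutput]
  · cases b <;> simp [printBranch, ofOutput]
  · simp [printBranch, printHeaders, print, recordOnes, copyOnes, ofArgs, ofOutput,
      PromiseHierarchy.combineStr, addHeaders, unary]

theorem PolyTimeComputable.insertStr (n : ℕ) (word : List Bool) (hμ : PolyTimeComputable μ) :
    PolyTimeComputable fun x => insertStr n word (μ x) := by
  have copy := feasible_transduce (T := .copy Bool) (fun _ _ => Option.some_ne_none _) () false
  refine (copy.comp ((feasible_print word).comp ((feasible_printHeaders (n + 1)).comp
    (feasible_clearArg true)))).polyTimeComputable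
    (F := fun u _ => PromiseHierarchy.insertStr n word u) (fun u _ => ?_) hμ hμ
  refine Registers.ext (funext fun b => ?_) rfl rfl ?_
  · have skip_nil : skip^[n] (skip []) = [] := Function.iterate_fixed rfl n
    cases b <;> simp [transduce, print, printHeaders, clearArg, ofOutput, skip_nil]
  · simp [transduce, print, printHeaders, clearArg, ofArgs, ofOutput, Transducer.output_copy,
      PromiseHierarchy.insertStr]

/-! ### The reductions -/

variable {n : ℕ} {ψ : PromiseProblem}

theorem onCodes_code (A : Input n → Answer) (F : Input n) : onCodes A F.code = A F :=
  (Input.code_injective n).extend_apply _ _ _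

theorem eq_univ_or_exists_code_of_onCodes_subset {A : Input n → Answer} {x : Str} {S : Set Bool}
    (h : (onCodes A x).1 ⊆ S) : S = Set.univ ∨ ∃ F : Input n, F.code = x ∧ (A F).1 ⊆ S := by
  by_cases hx : ∃ F : Input n, F.code = x
  · obtain ⟨F, rfl⟩ := hx
    exact .inr ⟨F, rfl, onCodes_code A F ▸ h⟩
  · rw [onCodes, Function.extend_apply' _ _ _ hx] at h
    exact .inl (Set.univ_subset_iff.1 h)

theorem StrongReduces.of_insertStr {A B : Input n → Answer} (h : StrongReduces ψ (onCodes A))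
    {word : List Bool} {f : Input n → Input n}
    (hword : ∀ F, insertStr n word F.code = (f F).code) (hf : ∀ F, (B (f F)).1 ⊆ (A F).1) :
    StrongReduces ψ (onCodes B) := by
  obtain ⟨μ, hμ, h⟩ := h
  refine ⟨_, hμ.insertStr n word, fun x => ?_⟩
  obtain huniv | ⟨F, hF, hA⟩ := eq_univ_or_exists_code_of_onCodes_subset (h x)
  · exact huniv ▸ Set.subset_univ _
  · rw [← hF, hword, onCodes_code]
    exact (hf F).trans hA

theorem StrongReduces.uval_of_usat_of_coUsat (h₁ : StrongReduces ψ (USAT (n + 1)))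
    (h₂ : StrongReduces ψ (CoUSAT (n + 1))) : StrongReduces ψ (UVAL (n + 1)) := by
  obtain ⟨μ₁, hμ₁, h₁⟩ := h₁
  obtain ⟨μ₂, hμ₂, h₂⟩ := h₂
  refine ⟨_, hμ₁.combineStr n hμ₂, fun x => ?_⟩
  obtain huniv | ⟨F, hF, hψF⟩ := eq_univ_or_exists_code_of_onCodes_subset (h₁ x)
  · exact huniv ▸ Set.subset_univ _
  obtain huniv | ⟨G, hG, hψG⟩ := eq_univ_or_exists_code_of_onCodes_subset (h₂ x)
  · exact huniv ▸ Set.subset_univ _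
  rw [← hF, ← hG, Input.combineStr_code, UVAL, onCodes_code]
  exact Input.uval_combine_subset hψF hψG

theorem StrongReduces.usat_of_uval (h : StrongReduces ψ (UVAL (n + 1))) :
    StrongReduces ψ (USAT (n + 1)) :=
  h.of_insertStr Input.insertStr_code_selectOne Input.usat_selectOne_subset_uval

theorem StrongReduces.coUsat_of_uval (h : StrongReduces ψ (UVAL (n + 1))) :
    StrongReduces ψ (CoUSAT (n + 1)) :=
  h.of_insertStr Input.insertStr_code_selectZero Input.coUsat_selectZero_subset_uval

end PromiseHierarchy

theorem theorem10 (n : ℕ) (hn : 1 ≤ n) :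
    PromiseHierarchy.strongClosure (PromiseHierarchy.UVAL n) =
      PromiseHierarchy.strongClosure (PromiseHierarchy.USAT n) ∩
        PromiseHierarchy.strongClosure (PromiseHierarchy.CoUSAT n) := by
  obtain ⟨n, rfl⟩ := Nat.exists_eq_add_of_le' hn
  ext ψ
  exact ⟨fun h => ⟨h.usat_of_uval, h.coUsat_of_uval⟩, fun h => h.1.uval_of_usat_of_coUsat h.2⟩
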